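/- Let $(M,g)$ be an $n$-dimensional smooth Riemannian manifold with Levi-Civita connection $\nabla$ and curvature $R(X,Y)=[\nabla_X,\nabla_Y]-\nabla_{[X,Y]}$, and let $f\in C^\infty(M)$, $f>0$. In the coordinates $(x^i,p_i)$ of $T^*M$ induced by coordinates $(x^i)$ of $M$, the vertical lift of a one-form $\omega$ and the horizontal lift of a vector field $X$ are $${}^V\omega=\omega_i\,\frac{\partial}{\partial p_i},\qquad {}^HX=X^i\frac{\partial}{\partial x^i}+p_h\Gamma^h_{ij}X^j\frac{\partial}{\partial p_i}.$$ At a point $(x,p)$ of $T^*M$ put $\alpha=1+g^{-1}(p,p)$, let $\gamma\delta=p_i\,\partial/\partial p_i$ be the Liouville vector field, and for a one-form $\omega$ let $\tilde\omega=g^{-1}\circ\omega$ be the vector field with $g(\tilde\omega,\cdot)=\omega$. Let $p\circ R(X,Y)$ be the covector $Z\mapsto p(R(X,Y)Z)$, and let $p\,(g^{-1}\circ R(\ ,X)\tilde\omega)$ be the vector that corresponds under $g$ to the covector $Z\mapsto p(R(Z,X)\tilde\omega)$. Put $${}^fA(X,Y)=\frac1{2f}\bigl(X(f)\,Y+Y(f)\,X-g(X,Y)\,\mathrm{grad}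 f\bigr).$$ The rescaled Cheeger–Gromoll type metric ${}^{CG}g_f$ on $T^*M$ is given by $${}^{CG}g_f({}^V\omega,{}^V\theta)=\frac1\alpha\bigl(g^{-1}(\omega,\theta)+g^{-1}(\omega,p)\,g^{-1}(\theta,p)\bigr),\quad {}^{CG}g_f({}^V\omega,{}^HY)=0,\quad {}^{CG}g_f({}^HX,{}^HY)=f\,g(X,Y).$$ Let $\widetilde\nabla$ be its Levi-Civita connection, let $J$ be the almost product structure on $T^*M$ with $J({}^HX)=-{}^HX$ and $J({}^V\omega)={}^V\omega$, and let $\widetilde\nabla^{(J)}_{\widetilde X}\widetilde Y=J(\widetilde\nabla_{\widetilde X}J\widetilde Y)$ be the product conjugate connection. Then $\widetilde\nabla^{(J)}$ is a linear connection on $T^*M$ which is metric with respect to ${}^{CG}g_f$, and for all smooth vector fields $X,Y$ and one-forms $\omega,\theta$ on $M$: i) $\widetilde\nabla^{(J)}_{{}^HX}{}^HY={}^H\bigl(\nabla_XY+{}^fA(X,Y)\bigr)-\frac12\,{}^V\bigl(p\circ R(X,Y)\bigr)$, ii) $\widetilde\nabla^{(J)}_{{}^HX}{}^V\theta=-\frac1{2f\alpha}\,{}^H\bigl(p\,(g^{-1}\circ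 R(\ ,X)\tilde\theta)\bigr)+{}^V(\nabla_X\theta)$, iii) $\widetilde\nabla^{(J)}_{{}^V\omega}{}^HY=\frac1{2f\alpha}\,{}^H\bigl(p\,(g^{-1}\circ R(\ ,Y)\tilde\omega)\bigr)$, iv) $\widetilde\nabla^{(J)}_{{}^V\omega}{}^V\theta=-\frac1\alpha\bigl({}^{CG}g_f({}^V\omega,\gamma\delta)\,{}^V\theta+{}^{CG}g_f({}^V\theta,\gamma\delta)\,{}^V\omega\bigr)+\frac{\alpha+1}\alpha\,{}^{CG}g_f({}^V\omega,{}^V\theta)\,\gamma\delta-\frac1\alpha\,{}^{CG}g_f({}^V\omega,\gamma\delta)\,{}^{CG}g_f({}^V\theta,\gamma\delta)\,\gamma\delta$. -/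

import Mathlib

open Bundle
open scoped Manifold ContDiff

noncomputable section

namespace CheegerGromoll

section Generic

variable {E : Type*} [NormedAddCommGroup E] [NormedSpace ℝ E]
  {H : Type*} [TopologicalSpace H] {I : ModelWithCorners ℝ E H}
  {N : Type*} [TopologicalSpace N] [ChartedSpace H N]

/-- The operator `D`, where `D Y y u` stands for `(D_u Y)(y)`, is compatible with the field `h` of
bilinear forms: `u (h(Y, Z)) = h(D_u Y, Z) + h(Y, D_u Z)` for all vector fields `Y`, `Z`
that are differentiable at the base point `y` of `u`. -/
def IsMetricFor [IsManifold I 1 N]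
    (h : ∀ y : N, TangentSpace I y → TangentSpace I y → ℝ)
    (D : (∀ y : N, TangentSpace I y) → ∀ y : N, TangentSpace I y →L[ℝ] TangentSpace I y) : Prop :=
  ∀ (Y Z : ∀ y : N, TangentSpace I y) (y : N),
    MDifferentiableAt I I.tangent (fun z ↦ (⟨z, Y z⟩ : TangentBundle I N)) y →
    MDifferentiableAt I I.tangent (fun z ↦ (⟨z, Z z⟩ : TangentBundle I N)) y →
    ∀ u : TangentSpace I y,
      mvfderiv I (fun z ↦ h z (Y z) (Z z)) y u = h y (D Y y u) (Z y) + h y (Y y) (D Z y u)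

/-- `D` is the Levi-Civita connection of the field `h` of bilinear forms: it is torsion-free and
compatible with `h`. -/
structure IsLeviCivita [FiniteDimensional ℝ E] [IsManifold I 2 N]
    (h : ∀ y : N, TangentSpace I y → TangentSpace I y → ℝ)
    (D : CovariantDerivative I E (TangentSpace I : N → Type _)) : Prop where
  torsion_eq_zero : haveI : CompleteSpace E := FiniteDimensional.complete ℝ E
    D.torsion = 0
  isMetric : IsMetricFor h D.toFun

end Generic

variable {E : Type*} [NormedAddCommGroup E] [NormedSpace ℝ E] [FiniteDimensional ℝ E]
  {M : Type*} [TopologicalSpace M] [ChartedSpace E M] [IsManifold 𝓘(ℝ, E) ∞ M]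

/-! ### Tensor calculus on the base manifold `M` -/

variable (E) in
/-- The cotangent space of `M` at `x`. -/
abbrev CoTan (x : M) : Type _ := TangentSpace 𝓘(ℝ, E) x →L[ℝ] ℝ

variable (E M) in
/-- Riemannian metrics of class `C^∞` on `M`. -/
abbrev Metric : Type _ :=
  ContMDiffRiemannianMetric 𝓘(ℝ, E) ∞ E (TangentSpace 𝓘(ℝ, E) : M → Type _)

variable (E M) in
/-- Linear connections on `M`. -/
abbrev Conn : Type _ := CovariantDerivative 𝓘(ℝ, E) E (TangentSpace 𝓘(ℝ, E) : M → Type _)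

/-- The map `v ↦ g(v, ·)` from `T_x M` to the dual of `T_x M`, as a linear isomorphism. -/
def flat (g : Metric E M) (x : M) :
    TangentSpace 𝓘(ℝ, E) x ≃ₗ[ℝ] Module.Dual ℝ (TangentSpace 𝓘(ℝ, E) x) :=
  haveI : FiniteDimensional ℝ (TangentSpace 𝓘(ℝ, E) x) := inferInstanceAs (FiniteDimensional ℝ E)
  LinearMap.linearEquivOfInjective
    { toFun := fun v ↦ (g.inner x v : TangentSpace 𝓘(ℝ, E) x →ₗ[ℝ] ℝ)
      map_add' := fun v w ↦ by ext; simp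
      map_smul' := fun c v ↦ by ext; simp }
    (by
      rw [← LinearMap.ker_eq_bot, LinearMap.ker_eq_bot']
      intro v hv
      by_contra hne
      have h0 : g.inner x v v = 0 := congrArg (fun l ↦ l v) hv
      exact (g.pos x v hne).ne' h0)
    Subspace.dual_finrank_eq.symm

/-- The vector `g⁻¹ ∘ β` with `g(g⁻¹ ∘ β, w) = β(w)` for all `w`. -/
def sharp (g : Metric E M) (x : M) (β : CoTan E x) : TangentSpace 𝓘(ℝ, E) x :=
  (flat g x).symm (β : TangentSpace 𝓘(ℝ, E) x →ₗ[ℝ] ℝ)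

theorem inner_sharp (g : Metric E M) (x : M) (β : CoTan E x) (w : TangentSpace 𝓘(ℝ, E) x) :
    g.inner x (sharp g x β) w = β w :=
  congrArg (fun l ↦ l w)
    ((flat g x).apply_symm_apply (β : TangentSpace 𝓘(ℝ, E) x →ₗ[ℝ] ℝ))

/-- The inner product `g⁻¹(β, θ) = g^{ij} β_i θ_j` of covectors. -/
def coInner (g : Metric E M) (x : M) (β θ : CoTan E x) : ℝ := β (sharp g x θ)

/-- The vector field that takes the value `w` at `x` and has constant components in the chart of
`M` at `x` (it is zero outside the domain of the chart). -/
def constField (x : M) (w : TangentSpace 𝓘(ℝ, E) x) (y : M) : TangentSpace 𝓘(ℝ, E) y :=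
  (trivializationAt E (TangentSpace 𝓘(ℝ, E)) x).symmₗ ℝ y
    ((trivializationAt E (TangentSpace 𝓘(ℝ, E)) x).linearMapAt ℝ x w)

theorem constField_self (x : M) (w : TangentSpace 𝓘(ℝ, E) x) : constField x w x = w :=
  Trivialization.symmₗ_linearMapAt _ (FiberBundle.mem_baseSet_trivializationAt' x) w

theorem mdifferentiableAt_constField (x : M) (w : TangentSpace 𝓘(ℝ, E) x) :
    MDifferentiableAt 𝓘(ℝ, E) 𝓘(ℝ, E).tangent
      (fun y ↦ (⟨y, constField x w y⟩ : TangentBundle 𝓘(ℝ, E) M)) x := by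
  refine (FiberBundle.mdifferentiableAt_extend 𝓘(ℝ, E) E w).congr_of_eventuallyEq ?_
  filter_upwards [(trivializationAt E (TangentSpace 𝓘(ℝ, E)) x).open_baseSet.mem_nhds
    (FiberBundle.mem_baseSet_trivializationAt' x)] with y hy
  refine congrArg (TotalSpace.mk y) ?_
  rw [constField, Trivialization.linearMapAt_apply,
    if_pos (FiberBundle.mem_baseSet_trivializationAt' x), Trivialization.symmₗ_apply _ hy]
  rfl

theorem constField_add (x : M) (v w : TangentSpace 𝓘(ℝ, E) x) :
    constField x (v + w) = constField x v + constField x w := by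
  funext y
  simp only [Pi.add_apply, constField, map_add]

theorem constField_smul (x : M) (c : ℝ) (w : TangentSpace 𝓘(ℝ, E) x) :
    constField x (c • w) = c • constField x w := by
  funext y
  simp only [Pi.smul_apply, constField, map_smul]

/-- The Christoffel symbols of `D` at `x` in the chart of `M` at `x`, which identifies `T_x M` with
`E`: `christoffel D x u w = D_u W` where `W = constField x w`, that is, in coordinates,
`(christoffel D x u w)^h = Γ^h_{ji} u^j w^i` with `D_{∂_j} ∂_i = Γ^h_{ji} ∂_h`. -/
def christoffel (D : Conn E M) (x : M) : E →L[ℝ] E →L[ℝ] E :=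
  (LinearMap.toContinuousLinearMap
    ({ toFun := fun w ↦ (D (constField x w) x : E →L[ℝ] E)
       map_add' := fun v w ↦ by
        rw [show constField x (v + w) = _ from constField_add x v w]
        exact D.isCovariantDerivativeOnUniv.add (mdifferentiableAt_constField x v)
          (mdifferentiableAt_constField x w)
       map_smul' := fun c w ↦ by
        rw [show constField x (c • w) = _ from constField_smul x c w]
        exact D.isCovariantDerivativeOnUniv.smul_const c
          (mdifferentiableAt_constField x w) } : E →ₗ[ℝ] E →L[ℝ] E)).flip

/-- The covariant derivative `D_u θ` of a one-form: `(D_i θ)_j = ∂_i θ_j - Γ^h_{ij} θ_h` in the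
chart at `x`. -/
def covForm (D : Conn E M) (θ : ∀ y : M, CoTan E y) (x : M) (u : TangentSpace 𝓘(ℝ, E) x) :
    CoTan E x :=
  (mvfderiv 𝓘(ℝ, E) (fun y ↦
      (trivializationAt (E →L[ℝ] ℝ) (fun y : M ↦ TangentSpace 𝓘(ℝ, E) y →L[ℝ] ℝ) x ⟨y, θ y⟩).2)
      x u : E →L[ℝ] ℝ) -
    (θ x : E →L[ℝ] ℝ).comp (christoffel D x u)

/-- `R(X, Y)Z = D_X D_Y Z - D_Y D_X Z - D_{[X, Y]} Z`. -/
def curvatureField (D : Conn E M) (X Y Z : ∀ y : M, TangentSpace 𝓘(ℝ, E) y) (x : M) :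
    TangentSpace 𝓘(ℝ, E) x :=
  D (fun y ↦ D Z y (Y y)) x (X x) - D (fun y ↦ D Z y (X y)) x (Y x) -
    D Z x (VectorField.mlieBracket 𝓘(ℝ, E) X Y x)

/-- The curvature tensor `(u, v, w) ↦ R(u, v)w` of `D` at `x`: the trilinear map with components
`R(∂_i, ∂_j)∂_k` in the coordinate frame of the chart at `x` (with respect to a basis of `E`). -/
def curvature (D : Conn E M) (x : M) : E →L[ℝ] E →L[ℝ] E →L[ℝ] E :=
  let b := Module.finBasis ℝ E
  let c := fun i ↦ LinearMap.toContinuousLinearMap (b.coord i)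
  ∑ i, ∑ j, ∑ k, (c i).smulRight ((c j).smulRight ((c k).smulRight
    (curvatureField D (constField x (b i)) (constField x (b j)) (constField x (b k)) x : E)))

/-- The tensor `fA(u, v) = (1 / 2f) (u(f) v + v(f) u - g(u, v) grad f)`. -/
def fA (g : Metric E M) (f : M → ℝ) (x : M) (u v : TangentSpace 𝓘(ℝ, E) x) :
    TangentSpace 𝓘(ℝ, E) x :=
  (1 / (2 * f x)) • (mvfderiv 𝓘(ℝ, E) f x u • v + mvfderiv 𝓘(ℝ, E) f x v • u -
    g.inner x u v • sharp g x (mvfderiv 𝓘(ℝ, E) f x))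

/-! ### The cotangent bundle -/

variable (E M) in
/-- The total space `T*M` of the cotangent bundle; a point is a pair `ξ = ⟨x, p⟩`. -/
abbrev CoBundle : Type _ := TotalSpace (E →L[ℝ] ℝ) (fun x : M ↦ TangentSpace 𝓘(ℝ, E) x →L[ℝ] ℝ)

variable (E) in
/-- The model with corners of the manifold `T*M`. -/
abbrev coModel : ModelWithCorners ℝ (E × (E →L[ℝ] ℝ)) (ModelProd E (E →L[ℝ] ℝ)) :=
  𝓘(ℝ, E).prod 𝓘(ℝ, E →L[ℝ] ℝ)

/-- The tangent space of `T*M` at `ξ = ⟨x, p⟩`. It is `E × E*`: the two components of a vector are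
its components in the coordinates of `T*M` induced by the chart of `M` at `x`, so that
`(u, a)` stands for `u^i ∂/∂x^i + a_i ∂/∂p_i`. -/
abbrev CoTangent (ξ : CoBundle E M) : Type _ := TangentSpace (coModel E) ξ

/-- The vertical lift `β_i ∂/∂p_i` at `ξ` of a covector `β`. -/
def vlift (ξ : CoBundle E M) (β : CoTan E ξ.proj) : CoTangent ξ :=
  ((0, β) : E × (E →L[ℝ] ℝ))

/-- The covector `p_h Γ^h_{ji} u^j dx^i`, at the point `ξ = ⟨x, p⟩`. -/
def christoffelForm (D : Conn E M) (ξ : CoBundle E M) : E →L[ℝ] E →L[ℝ] ℝ :=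
  (ContinuousLinearMap.compL ℝ E E ℝ (ξ.snd : E →L[ℝ] ℝ)).comp (christoffel D ξ.proj)

/-- The horizontal lift `u^i ∂/∂x^i + p_h Γ^h_{ji} u^j ∂/∂p_i` at `ξ = ⟨x, p⟩` of a tangent
vector `u`. -/
def hlift (D : Conn E M) (ξ : CoBundle E M) (u : TangentSpace 𝓘(ℝ, E) ξ.proj) : CoTangent ξ :=
  ((u, christoffelForm D ξ u) : E × (E →L[ℝ] ℝ))

/-- The vector `u` with horizontal part `hlift D ξ u` (the image under the differential of the
projection of `T*M` onto `M`). -/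
def hpart (ξ : CoBundle E M) (ζ : CoTangent ξ) : TangentSpace 𝓘(ℝ, E) ξ.proj :=
  (ζ : E × (E →L[ℝ] ℝ)).1

/-- The covector `β` with vertical part `vlift ξ β`. -/
def vpart (D : Conn E M) (ξ : CoBundle E M) (ζ : CoTangent ξ) : CoTan E ξ.proj :=
  (ζ : E × (E →L[ℝ] ℝ)).2 - christoffelForm D ξ (ζ : E × (E →L[ℝ] ℝ)).1

/-- Every tangent vector of `T*M` is the sum of its horizontal and vertical parts. -/
theorem hlift_add_vlift (D : Conn E M) (ξ : CoBundle E M) (ζ : CoTangent ξ) :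
    hlift D ξ (hpart ξ ζ) + vlift ξ (vpart D ξ ζ) = ζ := by
  change ((ζ : E × (E →L[ℝ] ℝ)).1 + 0, christoffelForm D ξ (ζ : E × (E →L[ℝ] ℝ)).1 +
    ((ζ : E × (E →L[ℝ] ℝ)).2 - christoffelForm D ξ (ζ : E × (E →L[ℝ] ℝ)).1)) = ζ
  rw [add_zero, add_sub_cancel]
  rfl

theorem hpart_hlift (D : Conn E M) (ξ : CoBundle E M) (u : TangentSpace 𝓘(ℝ, E) ξ.proj) :
    hpart ξ (hlift D ξ u) = u := rfl

theorem vpart_hlift (D : Conn E M) (ξ : CoBundle E M) (u : TangentSpace 𝓘(ℝ, E) ξ.proj) :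
    vpart D ξ (hlift D ξ u) = 0 :=
  sub_self (christoffelForm D ξ u)

theorem hpart_vlift (ξ : CoBundle E M) (β : CoTan E ξ.proj) :
    hpart ξ (vlift ξ β) = 0 := rfl

theorem vpart_vlift (D : Conn E M) (ξ : CoBundle E M) (β : CoTan E ξ.proj) :
    vpart D ξ (vlift ξ β) = β := by
  change (show E →L[ℝ] ℝ from β) - christoffelForm D ξ 0 = β
  rw [map_zero, sub_zero]

/-- `α = 1 + r²` with `r² = g⁻¹(p, p)`. -/
def alpha (g : Metric E M) (ξ : CoBundle E M) : ℝ := 1 + coInner g ξ.proj ξ.snd ξ.snd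

/-- The rescaled Cheeger-Gromoll type metric on `T*M`. -/
def cgMetric (g : Metric E M) (f : M → ℝ) (D : Conn E M) (ξ : CoBundle E M)
    (ζ η : CoTangent ξ) : ℝ :=
  f ξ.proj * g.inner ξ.proj (hpart ξ ζ) (hpart ξ η) +
    (1 / alpha g ξ) *
      (coInner g ξ.proj (vpart D ξ ζ) (vpart D ξ η) +
        coInner g ξ.proj (vpart D ξ ζ) ξ.snd * coInner g ξ.proj (vpart D ξ η) ξ.snd)

/-- The almost paracomplex (almost product) structure `J` on `T*M`. -/
def J (D : Conn E M) (ξ : CoBundle E M) : CoTangent ξ →L[ℝ] CoTangent ξ :=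
  (ContinuousLinearMap.prod (-ContinuousLinearMap.fst ℝ E (E →L[ℝ] ℝ))
    (ContinuousLinearMap.snd ℝ E (E →L[ℝ] ℝ) -
      (2 : ℝ) • (christoffelForm D ξ).comp (ContinuousLinearMap.fst ℝ E (E →L[ℝ] ℝ))) :
    E × (E →L[ℝ] ℝ) →L[ℝ] E × (E →L[ℝ] ℝ))

theorem J_hlift (D : Conn E M) (ξ : CoBundle E M) (u : TangentSpace 𝓘(ℝ, E) ξ.proj) :
    J D ξ (hlift D ξ u) = -hlift D ξ u := by
  change (-(u : E), christoffelForm D ξ u - (2 : ℝ) • christoffelForm D ξ u) =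
    (-(u : E), -christoffelForm D ξ u)
  congr 1
  module

theorem J_vlift (D : Conn E M) (ξ : CoBundle E M) (β : CoTan E ξ.proj) :
    J D ξ (vlift ξ β) = vlift ξ β := by
  change (-(0 : E), (show E →L[ℝ] ℝ from β) - (2 : ℝ) • christoffelForm D ξ 0) =
    ((0 : E), (show E →L[ℝ] ℝ from β))
  rw [map_zero, smul_zero, sub_zero, neg_zero]

theorem cgMetric_vlift_vlift (g : Metric E M) (f : M → ℝ) (D : Conn E M) (ξ : CoBundle E M)
    (β θ : CoTan E ξ.proj) :
    cgMetric g f D ξ (vlift ξ β) (vlift ξ θ) = (1 / alpha g ξ) *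
      (coInner g ξ.proj β θ + coInner g ξ.proj β ξ.snd * coInner g ξ.proj θ ξ.snd) := by
  simp [cgMetric, hpart_vlift, vpart_vlift]

theorem cgMetric_vlift_hlift (g : Metric E M) (f : M → ℝ) (D : Conn E M) (ξ : CoBundle E M)
    (β : CoTan E ξ.proj) (v : TangentSpace 𝓘(ℝ, E) ξ.proj) :
    cgMetric g f D ξ (vlift ξ β) (hlift D ξ v) = 0 := by
  have h (x : M) : sharp g x 0 = 0 := map_zero (flat g x).symm
  simp [cgMetric, hpart_vlift, vpart_hlift, coInner, h]

theorem cgMetric_hlift_hlift (g : Metric E M) (f : M → ℝ) (D : Conn E M) (ξ : CoBundle E M)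
    (u v : TangentSpace 𝓘(ℝ, E) ξ.proj) :
    cgMetric g f D ξ (hlift D ξ u) (hlift D ξ v) = f ξ.proj * g.inner ξ.proj u v := by
  simp [cgMetric, hpart_hlift, vpart_hlift, coInner]

variable (E M) in
/-- Linear connections on `T*M`. -/
abbrev CoConn : Type _ :=
  CovariantDerivative (coModel E) (E × (E →L[ℝ] ℝ))
    (TangentSpace (coModel E) : CoBundle E M → Type _)

/-- The product conjugate connection `D̃^{(J)}_X Y = J(D̃_X (JY))` of a connection `D̃` on `T*M`. -/
def conjugate (D : Conn E M) (Dt : CoConn E M) (Y : ∀ ξ : CoBundle E M, CoTangent ξ)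
    (ξ : CoBundle E M) : CoTangent ξ →L[ℝ] CoTangent ξ :=
  (J D ξ).comp (Dt (fun η ↦ J D η (Y η)) ξ)

/-- The vertical lift of a one-form. -/
def vliftForm (θ : ∀ x : M, CoTan E x) (ξ : CoBundle E M) : CoTangent ξ := vlift ξ (θ ξ.proj)

/-- The horizontal lift of a vector field. -/
def hliftField (D : Conn E M) (X : ∀ x : M, TangentSpace 𝓘(ℝ, E) x) (ξ : CoBundle E M) :
    CoTangent ξ := hlift D ξ (X ξ.proj)

/-- The canonical (Liouville) vector field `γδ = p_i ∂/∂p_i`. -/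
def liouville (ξ : CoBundle E M) : CoTangent ξ := vlift ξ ξ.snd

/-- The covector `p ∘ R(u, v) : w ↦ p(R(u, v)w)` at `ξ = ⟨x, p⟩`. -/
def pR (D : Conn E M) (ξ : CoBundle E M) (u v : TangentSpace 𝓘(ℝ, E) ξ.proj) :
    CoTan E ξ.proj :=
  (ξ.snd : E →L[ℝ] ℝ).comp (curvature D ξ.proj u v)

/-- The vector `p(g⁻¹ ∘ R( , u)β̃)` at `ξ = ⟨x, p⟩`, where `β̃ = g⁻¹ ∘ β`: the vector that `g`
associates with the covector `z ↦ p(R(z, u)β̃)`. -/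
def pRsharp (g : Metric E M) (D : Conn E M) (ξ : CoBundle E M)
    (u : TangentSpace 𝓘(ℝ, E) ξ.proj) (β : CoTan E ξ.proj) : TangentSpace 𝓘(ℝ, E) ξ.proj :=
  sharp g ξ.proj
    ((ξ.snd : E →L[ℝ] ℝ).comp
      (((curvature D ξ.proj).flip u).flip (sharp g ξ.proj β : E)) : E →L[ℝ] ℝ)

end CheegerGromoll

end

open CheegerGromoll

/-! The structure `J` is an involution (`J_J`), an isometry of the metric on `T*M` (`cgMetric_J`),
and preserves differentiability of vector fields (`mdifferentiableAt_J`). Conjugating a metric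
connection by such a `J` gives a metric connection: in the Leibniz rule the two copies of `J` cancel
on the undifferentiated field, and `J`, being an isometric involution, is self-adjoint. On lifts `J`
is multiplication by -1 (horizontal) or 1 (vertical). The four formulas therefore follow from the
Levi-Civita connection of the rescaled Cheeger–Gromoll metric by sign changes.

That connection is found by testing against lifts, which determine a tangent vector
(`eq_of_cgMetric`), and applying the Koszul formula (`IsLeviCivita.koszul`). Two inputs are needed.
The first is the brackets of lifts: `[HX, HY] = H[X, Y] + V(p ∘ R(X, Y))`, `[HX, Vθ] = V(∇_X θ)`,
`[Vβ, Vθ] = 0`. The second is the derivatives of the products of lifts. They rest on the facts that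
`g` is parallel (`mvfderiv_coInner`) and that the covariant derivative of the tautological covector
`p` is the vertical part of the direction (`hasCovDerivAt_snd`); in particular `α` is constant along
horizontal directions. Skew-symmetry of the curvature (`coInner_pR_snd`) removes the extra term
`g⁻¹(·, p) g⁻¹(·, p)` whenever one factor is `p ∘ R`. The tensor `fA` is the difference of the
Levi-Civita connections of `f g` and `g`.

All differentiation takes place in charts. Two points need care. No regularity of `D` is assumed, so
differentiability of its Christoffel symbols is read off from their expression through the smooth
metric (`christoffel_eq`). Moreover the lifts at a point are defined through the chart at that very
point, whereas a bracket needs their components in one fixed chart; `tco_hlift` and `tco_vlift`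
provide these. -/

noncomputable section

namespace CheegerGromoll

open Filter Topology

set_option maxSynthPendingDepth 3

/-! ### Vector fields, derivatives and brackets in a fixed chart -/

section Coordinates

variable {E : Type*} [NormedAddCommGroup E] [NormedSpace ℝ E]
  {H : Type*} [TopologicalSpace H] {I : ModelWithCorners ℝ E H}
  {N : Type*} [TopologicalSpace N] [ChartedSpace H N] [IsManifold I ∞ N]
  {F : Type*} [NormedAddCommGroup F] [NormedSpace ℝ F]

variable (I) in
/-- The components of a tangent vector at `y` in the chart at `x`. -/
def tco (x y : N) : TangentSpace I y →L[ℝ] E :=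
  (trivializationAt E (TangentSpace I) x).continuousLinearMapAt ℝ y

variable (I) in
/-- The tangent vector at `y` with given components in the chart at `x`. -/
def tsy (x y : N) : E →L[ℝ] TangentSpace I y :=
  (trivializationAt E (TangentSpace I) x).symmL ℝ y

theorem tco_tsy {x y : N} (hy : y ∈ (chartAt H x).source) (v : E) :
    tco I x y (tsy I x y v) = v :=
  Trivialization.continuousLinearMapAt_symmL _ (by simpa using hy) v

theorem tsy_tco {x y : N} (hy : y ∈ (chartAt H x).source) (v : TangentSpace I y) :
    tsy I x y (tco I x y v) = v :=
  Trivialization.symmL_continuousLinearMapAt _ (by simpa using hy) v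

theorem tco_eq_mfderiv {x y : N} (hy : y ∈ (chartAt H x).source) :
    tco I x y = mfderiv I 𝓘(ℝ, E) (extChartAt I x) y :=
  TangentBundle.continuousLinearMapAt_trivializationAt hy

theorem tco_self (x : N) (v : TangentSpace I x) : tco I x x v = v := by
  rw [tco_eq_mfderiv (mem_chart_source H x), mfderiv_extChartAt_self]
  rfl

theorem tsy_self (x : N) (v : E) : tsy I x x v = v := by
  have h := tsy_tco (I := I) (mem_chart_source H x) v
  exact (congrArg (tsy I x x) (tco_self (I := I) x v)).symm.trans h

/-- The components of a vector field in the chart at `x`. -/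
def rep (x : N) (Y : ∀ y : N, TangentSpace I y) (e : E) : E :=
  tco I x ((extChartAt I x).symm e) (Y ((extChartAt I x).symm e))

theorem rep_self (x : N) (Y : ∀ y : N, TangentSpace I y) :
    rep x Y (extChartAt I x x) = Y x := by
  rw [rep, extChartAt_to_inv, tco_self]

theorem rep_extChartAt {x y : N} (hy : y ∈ (chartAt H x).source)
    (Y : ∀ y : N, TangentSpace I y) : rep x Y (extChartAt I x y) = tco I x y (Y y) := by
  rw [rep, (extChartAt I x).left_inv (by simpa using hy)]

theorem trivializationAt_snd {x y : N} (hy : y ∈ (chartAt H x).source) (v : TangentSpace I y) :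
    (trivializationAt E (TangentSpace I) x ⟨y, v⟩).2 = tco I x y v := by
  rw [tco, Trivialization.continuousLinearMapAt_apply, Trivialization.linearMapAt_apply,
    if_pos (by simpa using hy)]

variable [I.Boundaryless]

theorem mdifferentiableAt_extChartAt_symm {x : N} {e : E} (he : e ∈ (extChartAt I x).target) :
    MDifferentiableAt 𝓘(ℝ, E) I (extChartAt I x).symm e := by
  have := mdifferentiableWithinAt_extChartAt_symm he
  rwa [I.range_eq_univ, mdifferentiableWithinAt_univ] at this

theorem mdifferentiableAt_iff_comp_symm {x y : N} (hy : y ∈ (chartAt H x).source) (h : N → F) :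
    MDifferentiableAt I 𝓘(ℝ, F) h y ↔
      DifferentiableAt ℝ (fun e ↦ h ((extChartAt I x).symm e)) (extChartAt I x y) := by
  have hy' : y ∈ (extChartAt I x).source := by simpa using hy
  rw [← mdifferentiableAt_iff_differentiableAt]
  constructor
  · intro hh
    refine MDifferentiableAt.comp (I' := I) _ ?_
      (mdifferentiableAt_extChartAt_symm ((extChartAt I x).map_source hy'))
    rwa [(extChartAt I x).left_inv hy']
  · intro hh
    refine (MDifferentiableAt.comp (I' := 𝓘(ℝ, E)) y hh
      (mdifferentiableAt_extChartAt hy)).congr_of_eventuallyEq ?_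
    filter_upwards [(isOpen_extChartAt_source (I := I) x).mem_nhds hy'] with z hz
    exact congrArg h ((extChartAt I x).left_inv hz).symm

theorem mvfderiv_eq_fderiv {x y : N} (hy : y ∈ (chartAt H x).source) {h : N → F}
    (hh : MDifferentiableAt I 𝓘(ℝ, F) h y) (u : TangentSpace I y) :
    mvfderiv I h y u =
      fderiv ℝ (fun e ↦ h ((extChartAt I x).symm e)) (extChartAt I x y) (tco I x y u) := by
  have hy' : y ∈ (extChartAt I x).source := by simpa using hy
  have hd := (mdifferentiableAt_iff_comp_symm hy h).1 hh
  have h1 : h =ᶠ[𝓝 y] (fun e ↦ h ((extChartAt I x).symm e)) ∘ extChartAt I x := by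
    filter_upwards [(isOpen_extChartAt_source (I := I) x).mem_nhds hy'] with z hz
    exact congrArg h ((extChartAt I x).left_inv hz).symm
  have h2 := (hd.hasFDerivAt.hasMFDerivAt.comp y
    (mdifferentiableAt_extChartAt hy).hasMFDerivAt).congr_of_eventuallyEq h1
  rw [tco_eq_mfderiv hy]
  exact congrArg (fun l : TangentSpace I y →L[ℝ] F ↦ l u) h2.mfderiv

theorem mdifferentiableAt_section_iff (x : N) (Y : ∀ y : N, TangentSpace I y) :
    MDifferentiableAt I I.tangent (fun z ↦ (⟨z, Y z⟩ : TangentBundle I N)) x ↔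
      DifferentiableAt ℝ (rep x Y) (extChartAt I x x) := by
  rw [mdifferentiableAt_section, mdifferentiableAt_iff_comp_symm (mem_chart_source H x)]
  refine Filter.EventuallyEq.differentiableAt_iff ?_
  filter_upwards [extChartAt_target_mem_nhds (I := I) x] with e he
  exact trivializationAt_snd (by simpa using (extChartAt I x).map_target he) _

/-- The bracket on a manifold is the bracket in `E` of the fields pulled back by the inverse chart.
The pulled-back fields are the component functions `rep`, because the derivative of the chart is
inverse to that of its inverse. At the centre of the chart the derivative is the identity, so
nothing has to be transported back. -/
theorem mlieBracket_eq [CompleteSpace E] (x : N) (X Y : ∀ y : N, TangentSpace I y) :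
    VectorField.mlieBracket I X Y x =
      fderiv ℝ (rep x Y) (extChartAt I x x) (X x) - fderiv ℝ (rep x X) (extChartAt I x x) (Y x) := by
  have key (Z : ∀ y : N, TangentSpace I y) :
      VectorField.mpullbackWithin 𝓘(ℝ, E) I (extChartAt I x).symm Z (Set.range I)
        =ᶠ[𝓝 (extChartAt I x x)] rep x Z := by
    filter_upwards [extChartAt_target_mem_nhds (I := I) x] with e he
    rw [VectorField.mpullbackWithin_apply, rep,
      tco_eq_mfderiv (by simpa using (extChartAt I x).map_target he)]
    have h1 := mfderiv_extChartAt_comp_mfderivWithin_extChartAt_symm (I := I) he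
    have h2 := mfderivWithin_extChartAt_symm_comp_mfderiv_extChartAt (I := I) he
    rw [ContinuousLinearMap.inverse_eq h2 h1]
    rfl
  have hX := key X
  have hY := key Y
  have e : ContinuousLinearMap.inverse (mfderiv I 𝓘(ℝ, E) (extChartAt I x) x) =
      ContinuousLinearMap.id ℝ (TangentSpace I x) := by
    rw [mfderiv_extChartAt_self]
    exact ContinuousLinearMap.inverse_id
  rw [VectorField.mlieBracket, VectorField.mlieBracketWithin_apply, e]
  simp only [Set.preimage_univ, Set.univ_inter]
  have h3 := hX.lieBracket_vectorField_eq (𝕜 := ℝ) hY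
  rw [I.range_eq_univ] at h3 ⊢
  refine Eq.trans (b := VectorField.lieBracket ℝ (rep x X) (rep x Y) (extChartAt I x x)) ?_ ?_
  · rw [← h3]
    exact congrFun VectorField.lieBracketWithin_univ _
  · rw [VectorField.lieBracket, rep_self, rep_self]

omit [I.Boundaryless] in
theorem mdifferentiableAt_tsy {x y : N} (hy : y ∈ (chartAt H x).source) (v : E) :
    MDifferentiableAt I I.tangent (fun z ↦ (⟨z, tsy I x z v⟩ : TangentBundle I N)) y := by
  rw [Trivialization.mdifferentiableAt_section_iff I (trivializationAt E (TangentSpace I) x)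
    (s := fun z ↦ tsy I x z v) (by simpa using hy)]
  refine (mdifferentiableAt_const (c := v)).congr_of_eventuallyEq ?_
  filter_upwards [(chartAt H x).open_source.mem_nhds hy] with z hz
  rw [trivializationAt_snd hz, tco_tsy hz]

-- Coordinate fields are pullbacks of constant fields under the chart, and pullback commutes with
-- the bracket. The point `y` is arbitrary in the chart domain: symmetry of the Christoffel symbols
-- is needed on a whole neighbourhood, not only at the centre.
omit [I.Boundaryless] in
theorem mlieBracket_tsy [CompleteSpace E] {x y : N} (hy : y ∈ (chartAt H x).source) (v w : E) :
    VectorField.mlieBracket I (fun z ↦ tsy I x z v) (fun z ↦ tsy I x z w) y = 0 := by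
  have : IsManifold I (minSmoothness ℝ 2) N := by
    rw [minSmoothness_of_isRCLikeNormedField]
    infer_instance
  let c (u : E) : ∀ z : E, TangentSpace 𝓘(ℝ, E) z := fun _ ↦ u
  have key (u : E) : (fun z ↦ tsy I x z u) =ᶠ[𝓝 y]
      VectorField.mpullback I 𝓘(ℝ, E) (extChartAt I x) (c u) := by
    filter_upwards [(chartAt H x).open_source.mem_nhds hy] with z hz
    have h : ContinuousLinearMap.inverse (tco I x z) = tsy I x z :=
      ContinuousLinearMap.inverse_eq (ContinuousLinearMap.ext (tco_tsy hz))
        (ContinuousLinearMap.ext (tsy_tco hz))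
    rw [tco_eq_mfderiv hz] at h
    exact (congrArg (fun l : E →L[ℝ] TangentSpace I z ↦ l u) h).symm
  have hc (u : E) : MDifferentiableAt 𝓘(ℝ, E) 𝓘(ℝ, E).tangent
      (fun z ↦ (⟨z, c u z⟩ : TangentBundle 𝓘(ℝ, E) E)) (extChartAt I x y) :=
    (contMDiffAt_vectorSpace_iff_contDiffAt.2
      (contDiffAt_const (n := 1) (c := u))).mdifferentiableAt one_ne_zero
  rw [(key v).mlieBracket_vectorField_eq (key w), ← VectorField.mpullback_mlieBracket
    (n := 2) (hc v) (hc w) (contMDiffAt_extChartAt' hy)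
    (by rw [minSmoothness_of_isRCLikeNormedField]),
    VectorField.mpullback_apply]
  have h0 : VectorField.mlieBracket 𝓘(ℝ, E) (c v) (c w) (extChartAt I x y) = 0 := by
    rw [← VectorField.mlieBracketWithin_univ, VectorField.mlieBracketWithin_eq_lieBracketWithin]
    change fderivWithin ℝ (fun _ ↦ w) _ _ _ - fderivWithin ℝ (fun _ ↦ v) _ _ _ = (0 : E)
    simp only [fderivWithin_fun_const]
    exact sub_self (0 : E)
  rw [h0, map_zero]

end Coordinates

/-! ### The Koszul formula -/

section Koszul

variable {E : Type*} [NormedAddCommGroup E] [NormedSpace ℝ E] [FiniteDimensional ℝ E]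
  {H : Type*} [TopologicalSpace H] {I : ModelWithCorners ℝ E H}
  {N : Type*} [TopologicalSpace N] [ChartedSpace H N] [IsManifold I ∞ N]
  {h : ∀ y : N, TangentSpace I y → TangentSpace I y → ℝ}
  {D : CovariantDerivative I E (TangentSpace I : N → Type _)}

theorem IsLeviCivita.sub_eq_mlieBracket (hD : IsLeviCivita h D)
    {X Y : ∀ y : N, TangentSpace I y} {y : N}
    (hX : MDifferentiableAt I I.tangent (fun z ↦ (⟨z, X z⟩ : TangentBundle I N)) y)
    (hY : MDifferentiableAt I I.tangent (fun z ↦ (⟨z, Y z⟩ : TangentBundle I N)) y) :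
    D Y y (X y) - D X y (Y y) = VectorField.mlieBracket I X Y y := by
  have : CompleteSpace E := FiniteDimensional.complete ℝ E
  exact (D.torsion_eq_zero_iff.1 hD.torsion_eq_zero) hX hY

/-- Vanishing torsion turns each bracket into a difference of covariant derivatives, and metric
compatibility expands each derivative; all terms but two equal ones then cancel. Symmetry of `h` and
subtractivity in its first slot suffice for this, so the formula serves both for `g` on `M` and for
`cgMetric` on `T*M`. -/
theorem IsLeviCivita.koszul (hD : IsLeviCivita h D) (hs : ∀ y u v, h y u v = h y v u)
    (hsub : ∀ y u v w, h y (u - v) w = h y u w - h y v w)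
    {A B C : ∀ y : N, TangentSpace I y} {y : N}
    (hA : MDifferentiableAt I I.tangent (fun z ↦ (⟨z, A z⟩ : TangentBundle I N)) y)
    (hB : MDifferentiableAt I I.tangent (fun z ↦ (⟨z, B z⟩ : TangentBundle I N)) y)
    (hC : MDifferentiableAt I I.tangent (fun z ↦ (⟨z, C z⟩ : TangentBundle I N)) y) :
    2 * h y (D B y (A y)) (C y) =
      mvfderiv I (fun z ↦ h z (B z) (C z)) y (A y) + mvfderiv I (fun z ↦ h z (A z) (C z)) y (B y) -
        mvfderiv I (fun z ↦ h z (A z) (B z)) y (C y) +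
        h y (VectorField.mlieBracket I A B y) (C y) - h y (VectorField.mlieBracket I A C y) (B y) -
        h y (VectorField.mlieBracket I B C y) (A y) := by
  rw [← hD.sub_eq_mlieBracket hA hB, ← hD.sub_eq_mlieBracket hA hC, ← hD.sub_eq_mlieBracket hB hC,
    hD.isMetric B C y hB hC, hD.isMetric A C y hA hC, hD.isMetric A B y hA hB]
  simp only [hsub]
  rw [hs y (A y), hs y (B y), hs y (A y)]
  ring

end Koszul
-- Riemannian calculus on an open subset of a vector space
section LocalCalculus

variable {E : Type*} [NormedAddCommGroup E] [NormedSpace ℝ E]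

/-- Evaluation on a basis identifies `F →L[ℝ] F'` with a finite power of `F'`, where smoothness is
tested componentwise. -/
theorem contDiffAt_clm_of_apply {F F' P : Type*} [NormedAddCommGroup F] [NormedSpace ℝ F]
    [NormedAddCommGroup F'] [NormedSpace ℝ F'] [NormedAddCommGroup P] [NormedSpace ℝ P]
    [FiniteDimensional ℝ F] {n : ℕ∞ω} {f : P → F →L[ℝ] F'} {z : P}
    (h : ∀ v, ContDiffAt ℝ n (fun y ↦ f y v) z) : ContDiffAt ℝ n f z := by
  let d := Module.finrank ℝ F
  have hd : d = Module.finrank ℝ (Fin d → ℝ) := (Module.finrank_fin_fun ℝ).symm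
  let e₁ := ContinuousLinearEquiv.ofFinrankEq hd
  let e₂ := (e₁.arrowCongr (1 : F' ≃L[ℝ] F')).trans (ContinuousLinearEquiv.piRing (Fin d))
  rw [← Function.id_comp f, ← e₂.symm_comp_self]
  exact e₂.symm.contDiff.contDiffAt.comp z (contDiffAt_pi.mpr fun i ↦ h _)

/-- On the open set `U`, the metric `G` is smooth, and `Γ` are its Christoffel symbols. -/
structure IsChristoffelOn (U : Set E) (G : E → E →L[ℝ] E →L[ℝ] ℝ) (Γ : E → E →L[ℝ] E →L[ℝ] E) :
    Prop where
  isOpen : IsOpen U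
  smooth : ∀ e ∈ U, ContDiffAt ℝ ∞ G e
  symm : ∀ e ∈ U, ∀ v w, G e v w = G e w v
  pos : ∀ e ∈ U, ∀ v ≠ 0, 0 < G e v v
  compat : ∀ e ∈ U, ∀ u v w, fderiv ℝ G e u v w = G e (Γ e u v) w + G e v (Γ e u w)
  torsion : ∀ e ∈ U, ∀ u v, Γ e u v = Γ e v u

namespace IsChristoffelOn

variable {U : Set E} {G : E → E →L[ℝ] E →L[ℝ] ℝ} {Γ : E → E →L[ℝ] E →L[ℝ] E}

theorem injective (h : IsChristoffelOn U G Γ) {e : E} (he : e ∈ U) : Function.Injective (G e) := by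
  rw [injective_iff_map_eq_zero]
  intro v hv
  by_contra hne
  have := h.pos e he v hne
  rw [hv] at this
  simp at this

variable [FiniteDimensional ℝ E]

theorem isInvertible (h : IsChristoffelOn U G Γ) {e : E} (he : e ∈ U) : (G e).IsInvertible := by
  have hfin : Module.finrank ℝ E = Module.finrank ℝ (E →L[ℝ] ℝ) := by
    rw [← LinearMap.toContinuousLinearMap.finrank_eq]
    exact Subspace.dual_finrank_eq.symm
  refine ⟨((G e : E →ₗ[ℝ] (E →L[ℝ] ℝ)).linearEquivOfInjective (h.injective he)
    hfin).toContinuousLinearEquiv, ?_⟩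
  ext v w
  rfl

theorem inverse_apply (h : IsChristoffelOn U G Γ) {e : E} (he : e ∈ U) (v : E) :
    (G e).inverse (G e v) = v := (h.isInvertible he).inverse_apply_self v

theorem apply_inverse (h : IsChristoffelOn U G Γ) {e : E} (he : e ∈ U) (a : E →L[ℝ] ℝ) :
    G e ((G e).inverse a) = a := (h.isInvertible he).self_apply_inverse a

theorem contDiffAt_inverse (h : IsChristoffelOn U G Γ) {e : E} (he : e ∈ U) :
    ContDiffAt ℝ ∞ (fun z ↦ (G z).inverse) e := by
  have : CompleteSpace E := FiniteDimensional.complete ℝ E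
  exact ((h.isInvertible he).contDiffAt_map_inverse).comp e (h.smooth e he)

/-- This is the Koszul formula for coordinate fields. Its role is to give regularity: the right-hand
side involves only the smooth metric and its first derivative. -/
theorem christoffel_eq (h : IsChristoffelOn U G Γ) {e : E} (he : e ∈ U) (u v : E) :
    Γ e u v = (G e).inverse ((1 / 2 : ℝ) •
      (fderiv ℝ G e u v + fderiv ℝ G e v u - ((fderiv ℝ G e).flip u).flip v)) := by
  rw [← h.inverse_apply he (Γ e u v)]
  congr 1
  ext w
  have h1 := h.compat e he u v w
  have h2 := h.compat e he v u w
  have h3 := h.compat e he w u v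
  simp only [_root_.smul_apply, _root_.sub_apply,
    _root_.add_apply, ContinuousLinearMap.flip_apply, smul_eq_mul, h1, h2, h3]
  rw [h.torsion e he v u, h.torsion e he w u, h.torsion e he w v, h.symm e he u (Γ e v w),
    h.symm e he v (Γ e u w)]
  ring

omit [FiniteDimensional ℝ E] in
theorem contDiffAt_fderiv (h : IsChristoffelOn U G Γ) {e : E} (he : e ∈ U) :
    ContDiffAt ℝ 1 (fderiv ℝ G) e :=
  (h.smooth e he).fderiv_right (m := 1) (by norm_cast)

omit [FiniteDimensional ℝ E] in
theorem differentiableAt (h : IsChristoffelOn U G Γ) {e : E} (he : e ∈ U) :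
    DifferentiableAt ℝ G e := (h.smooth e he).differentiableAt (by simp)

theorem differentiableAt_christoffel (h : IsChristoffelOn U G Γ) {e : E} (he : e ∈ U) :
    DifferentiableAt ℝ Γ e := by
  refine ContDiffAt.differentiableAt (n := 1) ?_ one_ne_zero
  refine contDiffAt_clm_of_apply fun u ↦ contDiffAt_clm_of_apply fun v ↦ ?_
  have hd (u : E) : ContDiffAt ℝ 1 (fun z ↦ fderiv ℝ G z u) e :=
    (h.contDiffAt_fderiv he).clm_apply contDiffAt_const
  have hk : ContDiffAt ℝ 1 (fun z ↦ (G z).inverse ((1 / 2 : ℝ) •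
      (fderiv ℝ G z u v + fderiv ℝ G z v u - ((fderiv ℝ G z).flip u).flip v))) e := by
    refine ((h.contDiffAt_inverse he).of_le (by norm_cast)).clm_apply
      (ContDiffAt.const_smul (1 / 2 : ℝ) ?_)
    refine (((hd u).clm_apply contDiffAt_const).add ((hd v).clm_apply contDiffAt_const)).sub ?_
    exact contDiffAt_clm_of_apply fun w ↦
      ((hd w).clm_apply contDiffAt_const).clm_apply contDiffAt_const
  refine hk.congr_of_eventuallyEq ?_
  filter_upwards [h.isOpen.mem_nhds he] with z hz
  exact h.christoffel_eq hz u v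

/-- The curvature of the Christoffel symbols `Γ`. -/
def localCurvature (Γ : E → E →L[ℝ] E →L[ℝ] E) (e u v w : E) : E :=
  fderiv ℝ Γ e u v w - fderiv ℝ Γ e v u w + Γ e u (Γ e v w) - Γ e v (Γ e u w)

/-- The function `G(w, w)`, with `w` constant, is differentiated twice, along `v` and then along
`u`. Apart from the term `G(Γ_v w, Γ_u w)`, symmetric in `u` and `v`, the result is twice the
product of `w` with `(∂_u Γ)_v w + Γ_u Γ_v w`. Antisymmetrising kills the second derivative and the
symmetric term, and leaves the curvature. -/
theorem localCurvature_self (h : IsChristoffelOn U G Γ) {e : E} (he : e ∈ U) (u v w : E) :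
    G e (localCurvature Γ e u v w) w = 0 := by
  have hsymm : fderiv ℝ (fderiv ℝ G) e u v w w = fderiv ℝ (fderiv ℝ G) e v u w w := by
    have := (((h.smooth e he).of_le (m := 2) (by norm_cast)).isSymmSndFDerivAt (by simp)) u v
    rw [this]
  have key (u v : E) : fderiv ℝ (fderiv ℝ G) e u v w w =
      2 * (G e (fderiv ℝ Γ e u v w) w + G e (Γ e u (Γ e v w)) w + G e (Γ e v w) (Γ e u w)) := by
    have hd := ((h.contDiffAt_fderiv he).differentiableAt one_ne_zero).hasFDerivAt
    have h1 := (((hd.clm_apply (hasFDerivAt_const v e)).clm_apply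
      (hasFDerivAt_const w e)).clm_apply (hasFDerivAt_const w e))
    have hG := (h.differentiableAt he).hasFDerivAt
    have hΓ := (h.differentiableAt_christoffel he).hasFDerivAt
    have h2 := ((hG.clm_apply ((hΓ.clm_apply (hasFDerivAt_const v e)).clm_apply
      (hasFDerivAt_const w e))).clm_apply (hasFDerivAt_const w e)).const_mul 2
    have h3 : (fun z ↦ fderiv ℝ G z v w w) =ᶠ[𝓝 e] fun z ↦ 2 * G z (Γ z v w) w := by
      filter_upwards [h.isOpen.mem_nhds he] with z hz
      rw [h.compat z hz, h.symm z hz w]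
      ring
    have h4 := congrArg (fun l ↦ l u) (h1.unique (h2.congr_of_eventuallyEq h3))
    simp at h4
    rw [h4, h.compat e he]
    ring
  have e1 := key u v
  have e2 := key v u
  rw [h.symm e he (Γ e v w)] at e1
  rw [hsymm, e2] at e1
  simp only [localCurvature, map_add, map_sub, _root_.add_apply,
    _root_.sub_apply]
  linarith

omit [FiniteDimensional ℝ E] in
theorem fderiv_apply_apply {e : E} (hd : DifferentiableAt ℝ G e) (u v w : E) :
    DifferentiableAt ℝ (fun z ↦ G z v w) e ∧
      fderiv ℝ (fun z ↦ G z v w) e u = fderiv ℝ G e u v w := by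
  have h := (hd.hasFDerivAt.clm_apply (hasFDerivAt_const v e)).clm_apply (hasFDerivAt_const w e)
  refine ⟨h.differentiableAt, ?_⟩
  rw [h.fderiv]
  simp

omit [FiniteDimensional ℝ E] in
/-- Metric compatibility determines the covariant derivative of a vector field `Y`. -/
theorem eq_of_metric (h : IsChristoffelOn U G Γ) {e : E} (he : e ∈ U) {Y : E → E}
    (hY : DifferentiableAt ℝ Y e) {u d : E}
    (hd : ∀ w, DifferentiableAt ℝ (fun z ↦ G z (Y z) w) e →
      fderiv ℝ (fun z ↦ G z (Y z) w) e u = G e d w + G e (Y e) (Γ e u w)) :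
    d = fderiv ℝ Y e u + Γ e u (Y e) := by
  refine h.injective he ?_
  ext w
  have hG := (((h.differentiableAt he).hasFDerivAt.clm_apply hY.hasFDerivAt).clm_apply
    (hasFDerivAt_const w e))
  have h1 := hd w hG.differentiableAt
  rw [hG.fderiv] at h1
  simp [h.compat e he] at h1 ⊢
  linarith

/-- Covariant differentiation of the inner product of two covectors. -/
theorem hasFDerivAt_coInner (h : IsChristoffelOn U G Γ) {P : Type*} [NormedAddCommGroup P]
    [NormedSpace ℝ P] {z : P} {q : P → E} {q' : P →L[ℝ] E} (hz : q z ∈ U)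
    (hq : HasFDerivAt q q' z) {a b : P → E →L[ℝ] ℝ} {a' b' : P →L[ℝ] E →L[ℝ] ℝ}
    (ha : HasFDerivAt a a' z) (hb : HasFDerivAt b b' z) :
    DifferentiableAt ℝ (fun y ↦ a y ((G (q y)).inverse (b y))) z ∧ ∀ ζ,
    fderiv ℝ (fun y ↦ a y ((G (q y)).inverse (b y))) z ζ =
      (a' ζ - (a z).comp (Γ (q z) (q' ζ))) ((G (q z)).inverse (b z)) +
      (b' ζ - (b z).comp (Γ (q z) (q' ζ))) ((G (q z)).inverse (a z)) := by
  have hK : HasFDerivAt (fun y ↦ (G (q y)).inverse) _ z :=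
    (((h.contDiffAt_inverse hz).differentiableAt (by simp)).hasFDerivAt).comp z hq
  have hG : HasFDerivAt (fun y ↦ G (q y)) _ z := ((h.differentiableAt hz).hasFDerivAt).comp z hq
  have hf := ha.clm_apply (hK.clm_apply hb)
  refine ⟨hf.differentiableAt, fun ζ ↦ ?_⟩
  -- The derivative `w'` of the raised covector is kept abstract, so the derivative of the inverse
  -- metric is never computed. Differentiating `b = G(q) w` expresses `b'` through `w'` and the
  -- derivative of `G`, which is governed by `Γ`.
  obtain ⟨w', hw⟩ : ∃ w', HasFDerivAt (fun y ↦ (G (q y)).inverse (b y)) w' z :=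
    ⟨_, hK.clm_apply hb⟩
  have hf' := ha.clm_apply hw
  have hb2 := (hG.clm_apply hw).congr_of_eventuallyEq (f₁ := b) (by
    filter_upwards [hq.continuousAt.preimage_mem_nhds (h.isOpen.mem_nhds hz)] with y hy
    rw [h.apply_inverse hy])
  rw [hf'.fderiv, hb.unique hb2]
  set w := (G (q z)).inverse (b z)
  set v := (G (q z)).inverse (a z)
  have hbz : b z = G (q z) w := (h.apply_inverse hz _).symm
  have haz : a z = G (q z) v := (h.apply_inverse hz _).symm
  rw [hbz, haz]
  simp [h.compat _ hz]
  rw [h.symm _ hz v, h.symm _ hz v, h.symm _ hz w (Γ _ _ v)]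
  ring

end IsChristoffelOn

/-- The horizontal lift of a vector field, in coordinates. -/
def hrep (Γ : E → E →L[ℝ] E →L[ℝ] E) (X : E → E) (z : E × (E →L[ℝ] ℝ)) : E × (E →L[ℝ] ℝ) :=
  (X z.1, z.2.comp (Γ z.1 (X z.1)))

/-- The vertical lift of a one-form, in coordinates. -/
def vrep (θ : E → E →L[ℝ] ℝ) (z : E × (E →L[ℝ] ℝ)) : E × (E →L[ℝ] ℝ) := (0, θ z.1)

theorem hasFDerivAt_hrep {Γ : E → E →L[ℝ] E →L[ℝ] E} {X : E → E} {z : E × (E →L[ℝ] ℝ)}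
    (hΓ : DifferentiableAt ℝ Γ z.1) (hX : DifferentiableAt ℝ X z.1) :
    DifferentiableAt ℝ (hrep Γ X) z ∧ ∀ ζ, fderiv ℝ (hrep Γ X) z ζ =
      (fderiv ℝ X z.1 ζ.1, ζ.2.comp (Γ z.1 (X z.1)) +
        z.2.comp (fderiv ℝ Γ z.1 ζ.1 (X z.1)) + z.2.comp (Γ z.1 (fderiv ℝ X z.1 ζ.1))) := by
  have hX' : HasFDerivAt (fun y : E × (E →L[ℝ] ℝ) ↦ X y.1) _ z :=
    hX.hasFDerivAt.comp z hasFDerivAt_fst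
  have hΓ' : HasFDerivAt (fun y : E × (E →L[ℝ] ℝ) ↦ Γ y.1) _ z :=
    hΓ.hasFDerivAt.comp z hasFDerivAt_fst
  have h := hX'.prodMk ((hasFDerivAt_snd (p := z)).clm_comp (hΓ'.clm_apply hX'))
  refine ⟨h.differentiableAt, fun ζ ↦ ?_⟩
  rw [show hrep Γ X = fun y ↦ (X y.1, y.2.comp (Γ y.1 (X y.1))) from rfl, h.fderiv]
  refine Prod.ext rfl ?_
  ext w
  simp
  ring

theorem hasFDerivAt_vrep {θ : E → E →L[ℝ] ℝ} {z : E × (E →L[ℝ] ℝ)}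
    (hθ : DifferentiableAt ℝ θ z.1) :
    DifferentiableAt ℝ (vrep θ) z ∧ ∀ ζ, fderiv ℝ (vrep θ) z ζ = (0, fderiv ℝ θ z.1 ζ.1) := by
  have hθ' : HasFDerivAt (fun y : E × (E →L[ℝ] ℝ) ↦ θ y.1) _ z :=
    hθ.hasFDerivAt.comp z hasFDerivAt_fst
  have h := (hasFDerivAt_const (0 : E) z).prodMk hθ'
  refine ⟨h.differentiableAt, fun ζ ↦ ?_⟩
  rw [show vrep θ = fun y ↦ (0, θ y.1) from rfl, h.fderiv]
  rfl

/-- The terms containing derivatives of `X` and `Y` assemble into the horizontal lift of the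
coordinate bracket. What remains is vertical and is `p` composed with the coordinate expression of
the curvature. -/
theorem bracket_hrep_hrep {Γ : E → E →L[ℝ] E →L[ℝ] E} {X Y : E → E} {z : E × (E →L[ℝ] ℝ)}
    (hΓ : DifferentiableAt ℝ Γ z.1) (hX : DifferentiableAt ℝ X z.1)
    (hY : DifferentiableAt ℝ Y z.1) :
    fderiv ℝ (hrep Γ Y) z (hrep Γ X z) - fderiv ℝ (hrep Γ X) z (hrep Γ Y z) =
      (fderiv ℝ Y z.1 (X z.1) - fderiv ℝ X z.1 (Y z.1),
        z.2.comp (Γ z.1 (fderiv ℝ Y z.1 (X z.1) - fderiv ℝ X z.1 (Y z.1)))) +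
      (0, z.2.comp (fderiv ℝ Γ z.1 (X z.1) (Y z.1) - fderiv ℝ Γ z.1 (Y z.1) (X z.1) +
        (Γ z.1 (X z.1)).comp (Γ z.1 (Y z.1)) - (Γ z.1 (Y z.1)).comp (Γ z.1 (X z.1)))) := by
  rw [(hasFDerivAt_hrep hΓ hX).2, (hasFDerivAt_hrep hΓ hY).2]
  refine Prod.ext (by simp [hrep]) ?_
  ext w
  simp [hrep]
  ring

/-- The horizontal lift is linear in `p`, so differentiating it in the direction `θ` produces
exactly the Christoffel correction that makes `∂_X θ` covariant. -/
theorem bracket_hrep_vrep {Γ : E → E →L[ℝ] E →L[ℝ] E} {X : E → E} {θ : E → E →L[ℝ] ℝ}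
    {z : E × (E →L[ℝ] ℝ)} (hΓ : DifferentiableAt ℝ Γ z.1) (hX : DifferentiableAt ℝ X z.1)
    (hθ : DifferentiableAt ℝ θ z.1) :
    fderiv ℝ (vrep θ) z (hrep Γ X z) - fderiv ℝ (hrep Γ X) z (vrep θ z) =
      (0, fderiv ℝ θ z.1 (X z.1) - (θ z.1).comp (Γ z.1 (X z.1))) := by
  rw [(hasFDerivAt_hrep hΓ hX).2, (hasFDerivAt_vrep hθ).2]
  refine Prod.ext (by simp [hrep, vrep]) ?_
  ext w
  simp [hrep, vrep]

end LocalCalculus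
open IsChristoffelOn

/-! ### The metric, connection and curvature of `M` in a chart -/

section Base

variable {E : Type*} [NormedAddCommGroup E] [NormedSpace ℝ E]
  {M : Type*} [TopologicalSpace M] [ChartedSpace E M] [IsManifold 𝓘(ℝ, E) ∞ M]

/-- The metric in the chart at `x`. -/
def metricRep (g : Metric E M) (x : M) (e : E) : E →L[ℝ] E →L[ℝ] ℝ :=
  (show E →L[ℝ] E →L[ℝ] ℝ from g.inner ((extChartAt 𝓘(ℝ, E) x).symm e)).bilinearComp
    (show E →L[ℝ] E from tsy 𝓘(ℝ, E) x ((extChartAt 𝓘(ℝ, E) x).symm e))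
    (show E →L[ℝ] E from tsy 𝓘(ℝ, E) x ((extChartAt 𝓘(ℝ, E) x).symm e))

theorem metricRep_eq (g : Metric E M) (x : M) (e v w : E) :
    metricRep g x e v w = g.inner ((extChartAt 𝓘(ℝ, E) x).symm e)
      (tsy 𝓘(ℝ, E) x ((extChartAt 𝓘(ℝ, E) x).symm e) v)
      (tsy 𝓘(ℝ, E) x ((extChartAt 𝓘(ℝ, E) x).symm e) w) := rfl

theorem metricRep_apply (g : Metric E M) {x y : M} (hy : y ∈ (chartAt E x).source) (v w : E) :
    metricRep g x (extChartAt 𝓘(ℝ, E) x y) v w =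
      g.inner y (tsy 𝓘(ℝ, E) x y v) (tsy 𝓘(ℝ, E) x y w) := by
  rw [metricRep, (extChartAt 𝓘(ℝ, E) x).left_inv (by simpa using hy)]
  rfl

theorem inner_eq_metricRep (g : Metric E M) {x y : M} (hy : y ∈ (chartAt E x).source)
    (v w : TangentSpace 𝓘(ℝ, E) y) :
    g.inner y v w =
      metricRep g x (extChartAt 𝓘(ℝ, E) x y) (tco 𝓘(ℝ, E) x y v) (tco 𝓘(ℝ, E) x y w) := by
  rw [metricRep_apply g hy, tsy_tco hy, tsy_tco hy]

theorem mem_chartAt_source_symm {x : M} {e : E} (he : e ∈ (extChartAt 𝓘(ℝ, E) x).target) :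
    (extChartAt 𝓘(ℝ, E) x).symm e ∈ (chartAt E x).source := by
  have := (extChartAt 𝓘(ℝ, E) x).map_target he
  rwa [extChartAt_source] at this

theorem constField_eq_tsy (x : M) (w : TangentSpace 𝓘(ℝ, E) x) :
    constField x w = fun z ↦ tsy 𝓘(ℝ, E) x z w := by
  funext z
  have h := tco_self (I := 𝓘(ℝ, E)) x w
  exact congrArg (tsy 𝓘(ℝ, E) x z) h

variable [FiniteDimensional ℝ E]

theorem contDiffAt_metricRep (g : Metric E M) (x : M) {e : E}
    (he : e ∈ (extChartAt 𝓘(ℝ, E) x).target) : ContDiffAt ℝ ∞ (metricRep g x) e := by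
  set y := (extChartAt 𝓘(ℝ, E) x).symm e with hy'
  have hy : y ∈ (chartAt E x).source := mem_chartAt_source_symm he
  refine contDiffAt_clm_of_apply fun v ↦ contDiffAt_clm_of_apply fun w ↦ ?_
  have hc (v : E) : ContMDiffAt 𝓘(ℝ, E) 𝓘(ℝ, E).tangent ∞
      (fun z ↦ (⟨z, tsy 𝓘(ℝ, E) x z v⟩ : TangentBundle 𝓘(ℝ, E) M)) y := by
    rw [Trivialization.contMDiffAt_section_iff (trivializationAt E (TangentSpace 𝓘(ℝ, E)) x)
      (s := fun z ↦ tsy 𝓘(ℝ, E) x z v) (by simpa using hy)]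
    refine (contMDiffAt_const (c := v)).congr_of_eventuallyEq ?_
    filter_upwards [(chartAt E x).open_source.mem_nhds hy] with z hz
    rw [trivializationAt_snd hz, tco_tsy hz]
  have h1 : ContMDiffAt 𝓘(ℝ, E) 𝓘(ℝ, ℝ) ∞
      (fun z ↦ g.inner z (tsy 𝓘(ℝ, E) x z v) (tsy 𝓘(ℝ, E) x z w)) y := by
    have := ContMDiffAt.clm_bundle_apply₂ (F₃ := ℝ) (E₃ := Bundle.Trivial M ℝ) (g.contMDiff y) (hc v) (hc w)
    exact (contMDiffAt_totalSpace.1 this).2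
  have h2 : ContMDiffAt 𝓘(ℝ, E) 𝓘(ℝ, E) ∞ (extChartAt 𝓘(ℝ, E) x).symm e :=
    (contMDiffOn_extChartAt_symm x).contMDiffAt ((isOpen_extChartAt_target x).mem_nhds he)
  exact (ContMDiffAt.comp e h1 h2).contDiffAt

/-- The Christoffel symbols of `D` in the chart at `x`. -/
def christoffelRep (D : Conn E M) (x : M) (e : E) : E →L[ℝ] E →L[ℝ] E :=
  open Classical in
  -- Linearity in `w` requires the coordinate fields to be differentiable at the point, which is
  -- known on the chart domain; elsewhere the value is set to 0.
  if h : (extChartAt 𝓘(ℝ, E) x).symm e ∈ (chartAt E x).source then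
    (LinearMap.toContinuousLinearMap
      ({ toFun := fun w ↦ (tco 𝓘(ℝ, E) x ((extChartAt 𝓘(ℝ, E) x).symm e)).comp
          ((D (fun z ↦ tsy 𝓘(ℝ, E) x z w) ((extChartAt 𝓘(ℝ, E) x).symm e)).comp
            (tsy 𝓘(ℝ, E) x ((extChartAt 𝓘(ℝ, E) x).symm e)))
         map_add' := fun v w ↦ by
          rw [show (fun z ↦ tsy 𝓘(ℝ, E) x z (v + w)) =
            (fun z ↦ tsy 𝓘(ℝ, E) x z v) + fun z ↦ tsy 𝓘(ℝ, E) x z w by funext z; simp,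
            D.isCovariantDerivativeOnUniv.add (mdifferentiableAt_tsy h v)
            (mdifferentiableAt_tsy h w)]
          ext u
          exact map_add (tco 𝓘(ℝ, E) x ((extChartAt 𝓘(ℝ, E) x).symm e)) _ _
         map_smul' := fun c w ↦ by
          rw [show (fun z ↦ tsy 𝓘(ℝ, E) x z (c • w)) =
            c • (fun z ↦ tsy 𝓘(ℝ, E) x z w) by funext z; simp,
            D.isCovariantDerivativeOnUniv.smul_const c (mdifferentiableAt_tsy h w)]
          ext u
          exact map_smul (tco 𝓘(ℝ, E) x ((extChartAt 𝓘(ℝ, E) x).symm e)) _ _ } : E →ₗ[ℝ] E →L[ℝ] E)).flip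
  else 0

theorem christoffelRep_apply (D : Conn E M) {x y : M} (hy : y ∈ (chartAt E x).source) (u w : E) :
    christoffelRep D x (extChartAt 𝓘(ℝ, E) x y) u w =
      tco 𝓘(ℝ, E) x y (D (fun z ↦ tsy 𝓘(ℝ, E) x z w) y (tsy 𝓘(ℝ, E) x y u)) := by
  obtain ⟨e, he, rfl⟩ : ∃ e ∈ (extChartAt 𝓘(ℝ, E) x).target, y = (extChartAt 𝓘(ℝ, E) x).symm e :=
    ⟨extChartAt 𝓘(ℝ, E) x y, (extChartAt 𝓘(ℝ, E) x).map_source (by simpa using hy),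
      ((extChartAt 𝓘(ℝ, E) x).left_inv (by simpa using hy)).symm⟩
  rw [(extChartAt 𝓘(ℝ, E) x).right_inv he, christoffelRep, dif_pos hy]
  rfl

theorem christoffel_eq_christoffelRep (D : Conn E M) (x : M) :
    christoffel D x = christoffelRep D x (extChartAt 𝓘(ℝ, E) x x) := by
  ext u w
  rw [christoffelRep_apply D (mem_chart_source E x)]
  refine Eq.trans ?_ (tco_self (I := 𝓘(ℝ, E)) x _).symm
  change D (constField x w) x u = D _ x (tsy 𝓘(ℝ, E) x x u)
  rw [show tsy 𝓘(ℝ, E) x x u = u from tsy_self x u]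
  exact congrArg (fun Z ↦ D Z x u) (constField_eq_tsy x w)

theorem fderiv_metricRep {g : Metric E M} {D : Conn E M}
    (hD : IsLeviCivita (fun x u v ↦ g.inner x u v) D) {x y : M} (hy : y ∈ (chartAt E x).source)
    (u v w : E) :
    fderiv ℝ (metricRep g x) (extChartAt 𝓘(ℝ, E) x y) u v w =
      metricRep g x (extChartAt 𝓘(ℝ, E) x y)
        (christoffelRep D x (extChartAt 𝓘(ℝ, E) x y) u v) w +
      metricRep g x (extChartAt 𝓘(ℝ, E) x y) v
        (christoffelRep D x (extChartAt 𝓘(ℝ, E) x y) u w) := by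
  have he : extChartAt 𝓘(ℝ, E) x y ∈ (extChartAt 𝓘(ℝ, E) x).target :=
    (extChartAt 𝓘(ℝ, E) x).map_source (by simpa using hy)
  have h1 := hD.isMetric (fun z ↦ tsy 𝓘(ℝ, E) x z v) (fun z ↦ tsy 𝓘(ℝ, E) x z w) y
    (mdifferentiableAt_tsy hy v) (mdifferentiableAt_tsy hy w) (tsy 𝓘(ℝ, E) x y u)
  obtain ⟨hd, h2⟩ := IsChristoffelOn.fderiv_apply_apply
    ((contDiffAt_metricRep g x he).differentiableAt (by simp)) u v w
  rw [mvfderiv_eq_fderiv hy ((mdifferentiableAt_iff_comp_symm hy _).2 hd), tco_tsy hy,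
    inner_eq_metricRep g hy, inner_eq_metricRep g hy, tco_tsy hy, tco_tsy hy] at h1
  rw [← h2, christoffelRep_apply D hy, christoffelRep_apply D hy]
  exact h1

theorem christoffelRep_symm {g : Metric E M} {D : Conn E M}
    (hD : IsLeviCivita (fun x u v ↦ g.inner x u v) D) {x y : M} (hy : y ∈ (chartAt E x).source)
    (u v : E) :
    christoffelRep D x (extChartAt 𝓘(ℝ, E) x y) u v =
      christoffelRep D x (extChartAt 𝓘(ℝ, E) x y) v u := by
  have : CompleteSpace E := FiniteDimensional.complete ℝ E
  have h := hD.sub_eq_mlieBracket (mdifferentiableAt_tsy hy u) (mdifferentiableAt_tsy hy v)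
  rw [mlieBracket_tsy hy, sub_eq_zero] at h
  rw [christoffelRep_apply D hy, christoffelRep_apply D hy, h]

/-- This is the bridge to the local calculus: the compatibility of `D` with `g` is evaluated on
coordinate fields, and vanishing torsion becomes symmetry of the symbols because these fields
commute. -/
theorem isChristoffelOn {g : Metric E M} {D : Conn E M}
    (hD : IsLeviCivita (fun x u v ↦ g.inner x u v) D) (x : M) :
    IsChristoffelOn (extChartAt 𝓘(ℝ, E) x).target (metricRep g x) (christoffelRep D x) where
  isOpen := isOpen_extChartAt_target x
  smooth e he := contDiffAt_metricRep g x he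
  symm e he v w := by
    rw [metricRep_eq, metricRep_eq, g.symm]
  pos e he v hv := by
    rw [metricRep_eq]
    refine g.pos _ _ fun h0 ↦ hv ?_
    have := tco_tsy (I := 𝓘(ℝ, E)) (mem_chartAt_source_symm he) v
    exact this.symm.trans ((congrArg (tco 𝓘(ℝ, E) x _) h0).trans (map_zero _))
  compat e he u v w := by
    have := fderiv_metricRep hD (mem_chartAt_source_symm he) u v w
    rwa [(extChartAt 𝓘(ℝ, E) x).right_inv he] at this
  torsion e he u v := by
    have := christoffelRep_symm hD (mem_chartAt_source_symm he) u v
    rwa [(extChartAt 𝓘(ℝ, E) x).right_inv he] at this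

/-- Testing metric compatibility against the coordinate fields already determines `D_u Y`, since `g`
is nondegenerate. No expansion of `Y` in a frame is required. -/
theorem connection_apply {g : Metric E M} {D : Conn E M}
    (hD : IsLeviCivita (fun x u v ↦ g.inner x u v) D) {x : M}
    {Y : ∀ y : M, TangentSpace 𝓘(ℝ, E) y}
    (hY : MDifferentiableAt 𝓘(ℝ, E) 𝓘(ℝ, E).tangent
      (fun z ↦ (⟨z, Y z⟩ : TangentBundle 𝓘(ℝ, E) M)) x) (u : E) :
    (D Y x u : E) = fderiv ℝ (rep x Y) (extChartAt 𝓘(ℝ, E) x x) u + christoffel D x u (Y x) := by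
  have hx := mem_chart_source E x
  have hC := isChristoffelOn hD x
  have hxt := mem_extChartAt_target (I := 𝓘(ℝ, E)) x
  rw [christoffel_eq_christoffelRep, ← rep_self (I := 𝓘(ℝ, E)) x Y]
  refine hC.eq_of_metric hxt ((mdifferentiableAt_section_iff x Y).1 hY) fun w hw ↦ ?_
  have he : (fun e ↦ g.inner ((extChartAt 𝓘(ℝ, E) x).symm e) (Y ((extChartAt 𝓘(ℝ, E) x).symm e))
      (tsy 𝓘(ℝ, E) x ((extChartAt 𝓘(ℝ, E) x).symm e) w)) =ᶠ[𝓝 (extChartAt 𝓘(ℝ, E) x x)]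
      fun z ↦ metricRep g x z (rep x Y z) w := by
    filter_upwards [extChartAt_target_mem_nhds (I := 𝓘(ℝ, E)) x] with e he
    rw [inner_eq_metricRep g (mem_chartAt_source_symm he), tco_tsy (mem_chartAt_source_symm he),
      (extChartAt 𝓘(ℝ, E) x).right_inv he]
    rfl
  have h1 (u : TangentSpace 𝓘(ℝ, E) x) :
      fderiv ℝ (fun z ↦ metricRep g x z (rep x Y z) w) (extChartAt 𝓘(ℝ, E) x x) u =
      metricRep g x (extChartAt 𝓘(ℝ, E) x x) (D Y x u) w +
      metricRep g x (extChartAt 𝓘(ℝ, E) x x) (Y x) (D (fun z ↦ tsy 𝓘(ℝ, E) x z w) x u) := by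
    have h := hD.isMetric Y (fun z ↦ tsy 𝓘(ℝ, E) x z w) x hY (mdifferentiableAt_tsy hx w) u
    rwa [mvfderiv_eq_fderiv hx ((mdifferentiableAt_iff_comp_symm hx _).2
      (hw.congr_of_eventuallyEq he)), he.fderiv_eq, tco_self, inner_eq_metricRep g hx,
      inner_eq_metricRep g hx, tco_tsy hx, tco_self, tco_self, tco_self] at h
  have h4 : christoffelRep D x (extChartAt 𝓘(ℝ, E) x x) u w =
      (D (fun z ↦ tsy 𝓘(ℝ, E) x z w) x u : E) := by
    rw [christoffelRep_apply D hx, show tsy 𝓘(ℝ, E) x x u = u from tsy_self x u]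
    exact tco_self (I := 𝓘(ℝ, E)) x _
  rw [rep_self, h4]
  exact h1 u

/-- The bracket term vanishes for coordinate fields. The inner covariant derivative has components
`Γ_v w` near `x`, and `connection_apply` differentiates it once more. -/
theorem curvatureField_tsy {g : Metric E M} {D : Conn E M}
    (hD : IsLeviCivita (fun x u v ↦ g.inner x u v) D) (x : M) (u v w : E) :
    (curvatureField D (fun z ↦ tsy 𝓘(ℝ, E) x z u) (fun z ↦ tsy 𝓘(ℝ, E) x z v)
      (fun z ↦ tsy 𝓘(ℝ, E) x z w) x : E) =
      localCurvature (christoffelRep D x) (extChartAt 𝓘(ℝ, E) x x) u v w := by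
  have hx := mem_chart_source E x
  have hC := isChristoffelOn hD x
  have hxt := mem_extChartAt_target (I := 𝓘(ℝ, E)) x
  have hΓ := (hC.differentiableAt_christoffel hxt).hasFDerivAt
  have : CompleteSpace E := FiniteDimensional.complete ℝ E
  have key (u v : E) : (D (fun y ↦ D (fun z ↦ tsy 𝓘(ℝ, E) x z w) y (tsy 𝓘(ℝ, E) x y v)) x u : E) =
      fderiv ℝ (christoffelRep D x) (extChartAt 𝓘(ℝ, E) x x) u v w +
      christoffelRep D x (extChartAt 𝓘(ℝ, E) x x) u
        (christoffelRep D x (extChartAt 𝓘(ℝ, E) x x) v w) := by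
    have hr : rep x (fun y ↦ D (fun z ↦ tsy 𝓘(ℝ, E) x z w) y (tsy 𝓘(ℝ, E) x y v))
        =ᶠ[𝓝 (extChartAt 𝓘(ℝ, E) x x)] fun e ↦ christoffelRep D x e v w := by
      filter_upwards [extChartAt_target_mem_nhds (I := 𝓘(ℝ, E)) x] with e he
      have h := christoffelRep_apply D (mem_chartAt_source_symm he) v w
      rw [(extChartAt 𝓘(ℝ, E) x).right_inv he] at h
      exact h.symm
    have hd := (hΓ.clm_apply (hasFDerivAt_const v _)).clm_apply (hasFDerivAt_const w _)
    rw [connection_apply hD ((mdifferentiableAt_section_iff x _).2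
      (hd.differentiableAt.congr_of_eventuallyEq hr)), hr.fderiv_eq, hd.fderiv,
      christoffel_eq_christoffelRep, ← rep_self (I := 𝓘(ℝ, E)) x
        (fun y ↦ D (fun z ↦ tsy 𝓘(ℝ, E) x z w) y (tsy 𝓘(ℝ, E) x y v)), hr.self_of_nhds]
    simp
    rfl
  rw [curvatureField, mlieBracket_tsy hx, map_zero]
  have h1 := key u v
  have h2 := key v u
  rw [localCurvature]
  refine (congrArg₂ (fun a b : E ↦ a - b - 0)
    ((congrArg (D _ x) (tsy_self (I := 𝓘(ℝ, E)) x u)).trans h1)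
    ((congrArg (D _ x) (tsy_self (I := 𝓘(ℝ, E)) x v)).trans h2)).trans ?_
  abel

theorem curvature_apply {g : Metric E M} {D : Conn E M}
    (hD : IsLeviCivita (fun x u v ↦ g.inner x u v) D) (x : M) (u v : E) :
    curvature D x u v =
      fderiv ℝ (christoffelRep D x) (extChartAt 𝓘(ℝ, E) x x) u v -
        fderiv ℝ (christoffelRep D x) (extChartAt 𝓘(ℝ, E) x x) v u +
        (christoffelRep D x (extChartAt 𝓘(ℝ, E) x x) u).comp
          (christoffelRep D x (extChartAt 𝓘(ℝ, E) x x) v) -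
        (christoffelRep D x (extChartAt 𝓘(ℝ, E) x x) v).comp
          (christoffelRep D x (extChartAt 𝓘(ℝ, E) x x) u) := by
  set Γ := christoffelRep D x
  set e := extChartAt 𝓘(ℝ, E) x x
  -- `curvature` is defined by its components on a basis. Bundling the right-hand side as a
  -- trilinear map allows the same expansion, after which the coefficients agree by
  -- `curvatureField_tsy`.
  let L : E →ₗ[ℝ] E →ₗ[ℝ] E →L[ℝ] E := LinearMap.mk₂ ℝ
    (fun u v ↦ fderiv ℝ Γ e u v - fderiv ℝ Γ e v u + (Γ e u).comp (Γ e v) - (Γ e v).comp (Γ e u))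
    (fun u u' v ↦ by ext w; simp; abel) (fun c u v ↦ by ext w; simp [smul_sub])
    (fun u v v' ↦ by ext w; simp; abel) (fun c u v ↦ by ext w; simp [smul_sub])
  have hL (u v w : E) : L u v w = localCurvature Γ e u v w := rfl
  change _ = L u v
  let b := Module.finBasis ℝ E
  have hsum {F : Type _} [AddCommGroup F] [Module ℝ F] (f : E →ₗ[ℝ] F) (u : E) :
      f u = ∑ i, b.coord i u • f (b i) := by
    conv_lhs => rw [← b.sum_repr u, map_sum]
    simp
  ext w
  have h1 : L u v w = ∑ i, ∑ j, ∑ k, b.coord i u • b.coord j v • b.coord k w • L (b i) (b j) (b k) := by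
    rw [hsum L u]
    simp only [LinearMap.sum_apply, LinearMap.smul_apply, _root_.sum_apply, _root_.smul_apply]
    refine Finset.sum_congr rfl fun i _ ↦ ?_
    rw [hsum (L (b i)) v]
    simp only [_root_.sum_apply, _root_.smul_apply, Finset.smul_sum]
    refine Finset.sum_congr rfl fun j _ ↦ ?_
    rw [show L (b i) (b j) w = ((L (b i) (b j) : E →L[ℝ] E) : E →ₗ[ℝ] E) w from rfl, hsum _ w]
    simp only [Finset.smul_sum]
    rfl
  have h2 (i j k) : (curvatureField D (constField x (b i)) (constField x (b j))
      (constField x (b k)) x : E) = L (b i) (b j) (b k) := by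
    rw [hL, ← curvatureField_tsy hD x]
    exact congr (congrArg₂ (fun X Y ↦ curvatureField D X Y) (constField_eq_tsy x (b i))
      (constField_eq_tsy x (b j))) (constField_eq_tsy x (b k)) ▸ rfl
  rw [h1]
  simp only [← h2]
  simp [curvature, b]
  rfl

/-- The components of a one-form in the chart at `x`. -/
def corep (x : M) (θ : ∀ y : M, CoTan E y) (e : E) : E →L[ℝ] ℝ :=
  (θ ((extChartAt 𝓘(ℝ, E) x).symm e)).comp (tsy 𝓘(ℝ, E) x ((extChartAt 𝓘(ℝ, E) x).symm e))

omit [FiniteDimensional ℝ E] in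
theorem cotangent_trivializationAt_snd (x y : M) (p : CoTan E y) :
    (trivializationAt (E →L[ℝ] ℝ) (fun y : M ↦ TangentSpace 𝓘(ℝ, E) y →L[ℝ] ℝ) x ⟨y, p⟩).2 =
      p.comp (tsy 𝓘(ℝ, E) x y) := by
  rw [hom_trivializationAt_apply]
  ext v
  simp [ContinuousLinearMap.inCoordinates, tsy]

omit [FiniteDimensional ℝ E] in
theorem corep_self (x : M) (θ : ∀ y : M, CoTan E y) : corep x θ (extChartAt 𝓘(ℝ, E) x x) = θ x := by
  rw [corep, extChartAt_to_inv]
  ext v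
  exact congrArg (θ x) (tsy_self (I := 𝓘(ℝ, E)) x v)

omit [FiniteDimensional ℝ E] in
theorem differentiableAt_corep {x : M} {θ : ∀ y : M, CoTan E y}
    (hθ : MDifferentiableAt 𝓘(ℝ, E) (coModel E) (fun z ↦ (⟨z, θ z⟩ : CoBundle E M)) x) :
    DifferentiableAt ℝ (corep x θ) (extChartAt 𝓘(ℝ, E) x x) := by
  rw [mdifferentiableAt_section, mdifferentiableAt_iff_comp_symm (mem_chart_source E x)] at hθ
  simp only [cotangent_trivializationAt_snd] at hθ
  exact hθ

theorem covForm_apply (D : Conn E M) {x : M} {θ : ∀ y : M, CoTan E y}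
    (hθ : MDifferentiableAt 𝓘(ℝ, E) (coModel E) (fun z ↦ (⟨z, θ z⟩ : CoBundle E M)) x) (u : E) :
    (covForm D θ x u : E →L[ℝ] ℝ) = fderiv ℝ (corep x θ) (extChartAt 𝓘(ℝ, E) x x) u -
      (show E →L[ℝ] ℝ from θ x).comp (christoffel D x u) := by
  refine congrArg (fun a : E →L[ℝ] ℝ ↦ a - (show E →L[ℝ] ℝ from θ x).comp (christoffel D x u)) ?_
  have h1 := (mdifferentiableAt_section _ _).1 hθ
  refine (mvfderiv_eq_fderiv (mem_chart_source E x) h1 _).trans ?_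
  simp only [cotangent_trivializationAt_snd]
  exact congrArg (fderiv ℝ (corep x θ) (extChartAt 𝓘(ℝ, E) x x)) (tco_self (I := 𝓘(ℝ, E)) x u)

theorem tco_sharp {g : Metric E M} {D : Conn E M}
    (hD : IsLeviCivita (fun x u v ↦ g.inner x u v) D) {x y : M} (hy : y ∈ (chartAt E x).source)
    (β : CoTan E y) :
    tco 𝓘(ℝ, E) x y (sharp g y β) =
      (metricRep g x (extChartAt 𝓘(ℝ, E) x y)).inverse (β.comp (tsy 𝓘(ℝ, E) x y)) := by
  rw [← (isChristoffelOn hD x).inverse_apply ((extChartAt 𝓘(ℝ, E) x).map_source (by simpa using hy))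
    (tco 𝓘(ℝ, E) x y (sharp g y β))]
  congr 1
  ext w
  rw [metricRep_apply g hy, tsy_tco hy, inner_sharp]
  rfl

theorem coInner_eq {g : Metric E M} {D : Conn E M}
    (hD : IsLeviCivita (fun x u v ↦ g.inner x u v) D) {x y : M} (hy : y ∈ (chartAt E x).source)
    (β θ : CoTan E y) :
    coInner g y β θ = (β.comp (tsy 𝓘(ℝ, E) x y))
      ((metricRep g x (extChartAt 𝓘(ℝ, E) x y)).inverse (θ.comp (tsy 𝓘(ℝ, E) x y))) := by
  rw [← tco_sharp hD hy, coInner]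
  exact congrArg β (tsy_tco hy _).symm

end Base
-- Change of chart for tangent vectors
section Curves

variable {E : Type*} [NormedAddCommGroup E] [NormedSpace ℝ E]
  {H : Type*} [TopologicalSpace H] {I : ModelWithCorners ℝ E H}
  {N : Type*} [TopologicalSpace N] [ChartedSpace H N] [IsManifold I ∞ N]
  {E' : Type*} [NormedAddCommGroup E'] [NormedSpace ℝ E']
  {H' : Type*} [TopologicalSpace H'] {I' : ModelWithCorners ℝ E' H'}
  {P : Type*} [TopologicalSpace P] [ChartedSpace H' P]

theorem tco_mfderiv {x : N} {c : P → N} {z : P} (hz : c z ∈ (chartAt H x).source)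
    (hc : MDifferentiableAt I' I c z) (v : TangentSpace I' z) :
    tco I x (c z) (mfderiv I' I c z v) = mvfderiv I' (fun y ↦ extChartAt I x (c y)) z v := by
  rw [tco_eq_mfderiv hz]
  exact (congrArg (fun l : TangentSpace I' z →L[ℝ] E ↦ l v)
    (mfderiv_comp z (mdifferentiableAt_extChartAt (I := I) hz) hc)).symm

/-- A tangent vector is stored as its components in the chart at its own base point. Once it is
realised as a derivative of some map `c`, its components in another chart are found by reading `c`
in that chart. This replaces computations with transition functions of `T*M`. -/
theorem tco_mvfderiv {x : N} {c : P → N} {z : P} (hz : c z ∈ (chartAt H x).source)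
    (hc : MDifferentiableAt I' I c z) (v : TangentSpace I' z) :
    tco I x (c z) (mvfderiv I' (F := E) (fun y ↦ extChartAt I (c z) (c y)) z v) =
      mvfderiv I' (fun y ↦ extChartAt I x (c y)) z v := by
  refine Eq.trans (congrArg (tco I x (c z)) ?_) (tco_mfderiv hz hc v)
  exact (tco_mfderiv (mem_chart_source H (c z)) hc v).symm.trans (tco_self (c z) _)

end Curves

/-! ### Lifts in a fixed chart of the cotangent bundle -/

section Cotangent

variable {E : Type*} [NormedAddCommGroup E] [NormedSpace ℝ E]
  {M : Type*} [TopologicalSpace M] [ChartedSpace E M] [IsManifold 𝓘(ℝ, E) ∞ M]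

theorem extChartAt_cotangent (ξ η : CoBundle E M) :
    extChartAt (coModel E) ξ η =
      (extChartAt 𝓘(ℝ, E) ξ.proj η.proj, η.snd.comp (tsy 𝓘(ℝ, E) ξ.proj η.proj)) := by
  have h := cotangent_trivializationAt_snd ξ.proj η.proj η.snd
  rw [FiberBundle.extChartAt, PartialEquiv.coe_trans, Function.comp_apply]
  rw [← h]
  rfl

theorem mem_chartAt_cotangent_source {ξ η : CoBundle E M} :
    η ∈ (chartAt (ModelProd E (E →L[ℝ] ℝ)) ξ).source ↔ η.proj ∈ (chartAt E ξ.proj).source := by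
  rw [FiberBundle.chartedSpace_chartAt]
  simp
  exact id
/-- The covector at `y` with given components in the chart at `x`. -/
def cosy (x y : M) (q : E →L[ℝ] ℝ) : CoTan E y := q.comp (tco 𝓘(ℝ, E) x y)

theorem cosy_comp_tsy {x y : M} (hy : y ∈ (chartAt E x).source) (q : E →L[ℝ] ℝ) :
    (cosy x y q).comp (tsy 𝓘(ℝ, E) x y) = q := by
  ext v
  exact congrArg q (tco_tsy hy v)

theorem mdifferentiableAt_fiber (y : M) (p : E →L[ℝ] ℝ) :
    MDifferentiableAt 𝓘(ℝ, E →L[ℝ] ℝ) (coModel E)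
      (fun q : E →L[ℝ] ℝ ↦ (⟨y, q⟩ : CoBundle E M)) p := by
  rw [mdifferentiableAt_totalSpace]
  refine ⟨mdifferentiableAt_const, ?_⟩
  have h : (fun q : E →L[ℝ] ℝ ↦ (trivializationAt (E →L[ℝ] ℝ)
      (fun y : M ↦ TangentSpace 𝓘(ℝ, E) y →L[ℝ] ℝ) y ⟨y, q⟩).2) =
      (ContinuousLinearMap.compL ℝ E E ℝ).flip (tsy 𝓘(ℝ, E) y y) :=
    funext fun q ↦ cotangent_trivializationAt_snd y y q
  refine MDifferentiableAt.congr_of_eventuallyEq ?_ (Eventually.of_forall (congrFun h))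
  exact (((ContinuousLinearMap.compL ℝ E E ℝ).flip
    (tsy 𝓘(ℝ, E) y y)).differentiableAt (x := p)).mdifferentiableAt

theorem mvfderiv_fiber (ξ : CoBundle E M) (y : M) (p β : E →L[ℝ] ℝ) :
    mvfderiv 𝓘(ℝ, E →L[ℝ] ℝ)
      (fun q : E →L[ℝ] ℝ ↦ extChartAt (coModel E) ξ (⟨y, q⟩ : CoBundle E M)) p β =
      (0, β.comp (tsy 𝓘(ℝ, E) ξ.proj y)) := by
  simp only [extChartAt_cotangent]
  have h := (hasFDerivAt_const (extChartAt 𝓘(ℝ, E) ξ.proj y) p).prodMk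
    (((ContinuousLinearMap.compL ℝ E E ℝ).flip (tsy 𝓘(ℝ, E) ξ.proj y)).hasFDerivAt (x := p))
  exact congrArg (fun l : (E →L[ℝ] ℝ) →L[ℝ] E × (E →L[ℝ] ℝ) ↦ l β)
    (h.hasMFDerivAt.mfderiv)

/-- A vertical vector is a derivative of the inclusion of a fibre, and this inclusion is affine in
every induced chart. -/
theorem tco_mvfderiv_fiber {ξ : CoBundle E M} {y : M} (hy : y ∈ (chartAt E ξ.proj).source)
    (p β : E →L[ℝ] ℝ) :
    tco (coModel E) ξ ⟨y, p⟩ ((0, β) : E × (E →L[ℝ] ℝ)) =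
      (0, β.comp (tsy 𝓘(ℝ, E) ξ.proj y)) := by
  have h := tco_mvfderiv (I := coModel E) (I' := 𝓘(ℝ, E →L[ℝ] ℝ)) (x := ξ)
    (c := fun q : E →L[ℝ] ℝ ↦ (⟨y, q⟩ : CoBundle E M)) (z := p)
    (mem_chartAt_cotangent_source.2 hy) (mdifferentiableAt_fiber y p) β
  have h0 : β.comp (tsy 𝓘(ℝ, E) y y) = β :=
    ContinuousLinearMap.ext fun v ↦ congrArg β (tsy_self (I := 𝓘(ℝ, E)) y v)
  have h1 := (mvfderiv_fiber (⟨y, p⟩ : CoBundle E M) y p β).trans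
    (congrArg (fun a : E →L[ℝ] ℝ ↦ ((0 : E), a)) h0)
  exact Eq.trans (congrArg (tco (coModel E) ξ ⟨y, p⟩) h1.symm)
    (h.trans (mvfderiv_fiber ξ y p β))

theorem tco_vlift {ξ η : CoBundle E M} (hη : η.proj ∈ (chartAt E ξ.proj).source)
    (β : CoTan E η.proj) :
    tco (coModel E) ξ η (vlift η β) = (0, β.comp (tsy 𝓘(ℝ, E) ξ.proj η.proj)) :=
  tco_mvfderiv_fiber hη η.snd β

theorem cosy_comp {x y : M} (hy : y ∈ (chartAt E x).source) (p : CoTan E y) :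
    cosy x y (p.comp (tsy 𝓘(ℝ, E) x y)) = p := by
  ext v
  exact congrArg p (tsy_tco hy v)

theorem mdifferentiableAt_cosy {x y : M} (hy : y ∈ (chartAt E x).source) (q : E →L[ℝ] ℝ) :
    MDifferentiableAt 𝓘(ℝ, E) (coModel E) (fun z ↦ (⟨z, cosy x z q⟩ : CoBundle E M)) y := by
  rw [Trivialization.mdifferentiableAt_section_iff 𝓘(ℝ, E)
    (trivializationAt (E →L[ℝ] ℝ) (fun y : M ↦ TangentSpace 𝓘(ℝ, E) y →L[ℝ] ℝ) x)
    (s := fun z ↦ cosy x z q) (by simpa using hy)]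
  refine (mdifferentiableAt_const (c := q)).congr_of_eventuallyEq ?_
  filter_upwards [(chartAt E x).open_source.mem_nhds hy] with z hz
  rw [cotangent_trivializationAt_snd, cosy_comp_tsy hz]

variable [FiniteDimensional ℝ E]

theorem covForm_pairing {g : Metric E M} {D : Conn E M}
    (hD : IsLeviCivita (fun x u v ↦ g.inner x u v) D) {x : M}
    {Y : ∀ y : M, TangentSpace 𝓘(ℝ, E) y} {θ : ∀ y : M, CoTan E y}
    (hY : MDifferentiableAt 𝓘(ℝ, E) 𝓘(ℝ, E).tangent
      (fun z ↦ (⟨z, Y z⟩ : TangentBundle 𝓘(ℝ, E) M)) x)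
    (hθ : MDifferentiableAt 𝓘(ℝ, E) (coModel E) (fun z ↦ (⟨z, θ z⟩ : CoBundle E M)) x) (u : E) :
    fderiv ℝ (fun e ↦ corep x θ e (rep x Y e)) (extChartAt 𝓘(ℝ, E) x x) u =
      (covForm D θ x u : E →L[ℝ] ℝ) (Y x) + (θ x : E →L[ℝ] ℝ) (D Y x u) := by
  have h1 := (differentiableAt_corep hθ).hasFDerivAt.clm_apply
    ((mdifferentiableAt_section_iff x Y).1 hY).hasFDerivAt
  have aux (p a : E →L[ℝ] ℝ) (A : E →L[ℝ] E) (y d : E) :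
      p d + a y = (a - p.comp A) y + p (d + A y) := by simp; ring
  rw [h1.fderiv, covForm_apply D hθ, connection_apply hD hY, rep_self, corep_self]
  exact aux (θ x) (fderiv ℝ (corep x θ) (extChartAt 𝓘(ℝ, E) x x) u) (christoffel D x u) (Y x)
    (fderiv ℝ (rep x Y) (extChartAt 𝓘(ℝ, E) x x) u)

/-- The form and the coordinate field `W` have constant components in the chart at `x`, so their
pairing is constant near `y`, whichever chart is used to differentiate it. Hence `(D_u θ)(W) =
-θ(D_u W)`. -/
theorem covForm_cosy {g : Metric E M} {D : Conn E M}
    (hD : IsLeviCivita (fun x u v ↦ g.inner x u v) D) {x y : M} (hy : y ∈ (chartAt E x).source)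
    (q : E →L[ℝ] ℝ) (u : TangentSpace 𝓘(ℝ, E) y) :
    (covForm D (fun z ↦ cosy x z q) y u).comp (tsy 𝓘(ℝ, E) x y) =
      -q.comp (christoffelRep D x (extChartAt 𝓘(ℝ, E) x y) (tco 𝓘(ℝ, E) x y u)) := by
  ext w
  have h := covForm_pairing hD (mdifferentiableAt_tsy hy w) (mdifferentiableAt_cosy hy q) u
  have hc : (fun e ↦ corep y (fun z ↦ cosy x z q) e (rep y (fun z ↦ tsy 𝓘(ℝ, E) x z w) e))
      =ᶠ[𝓝 (extChartAt 𝓘(ℝ, E) y y)] fun _ ↦ q w := by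
    have hc' := (continuousAt_extChartAt_symm (I := 𝓘(ℝ, E)) y).preimage_mem_nhds
      (by rw [extChartAt_to_inv]; exact (chartAt E x).open_source.mem_nhds hy)
    filter_upwards [extChartAt_target_mem_nhds (I := 𝓘(ℝ, E)) y, hc'] with e he he'
    have h1 := tsy_tco (I := 𝓘(ℝ, E)) (mem_chartAt_source_symm he)
      (tsy 𝓘(ℝ, E) x ((extChartAt 𝓘(ℝ, E) y).symm e) w)
    exact (congrArg (cosy x _ q) h1).trans (congrArg q (tco_tsy he' w))
  rw [hc.fderiv_eq, fderiv_fun_const] at h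
  have h2 := christoffelRep_apply D hy (tco 𝓘(ℝ, E) x y u) w
  rw [tsy_tco hy] at h2
  change _ = -(q (christoffelRep D x (extChartAt 𝓘(ℝ, E) x y) (tco 𝓘(ℝ, E) x y u) w))
  rw [h2]
  exact eq_neg_of_add_eq_zero_left h.symm

/-- Through the point `η` passes the one-form with constant components in the chart at `ξ`. Its
derivative along `u` is read in two ways: in the chart at `ξ` it has no fibre component, and at `η`
it is the horizontal lift of `u` plus the vertical lift of the covariant derivative of the form. The
vertical term is known from `tco_vlift` and `covForm_cosy`, so the horizontal one follows without
the transformation law of Christoffel symbols. -/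
theorem tco_hlift {g : Metric E M} {D : Conn E M}
    (hD : IsLeviCivita (fun x u v ↦ g.inner x u v) D) {ξ η : CoBundle E M}
    (hη : η.proj ∈ (chartAt E ξ.proj).source) (u : TangentSpace 𝓘(ℝ, E) η.proj) :
    tco (coModel E) ξ η (hlift D η u) = (tco 𝓘(ℝ, E) ξ.proj η.proj u,
      (η.snd.comp (tsy 𝓘(ℝ, E) ξ.proj η.proj)).comp
        (christoffelRep D ξ.proj (extChartAt 𝓘(ℝ, E) ξ.proj η.proj)
          (tco 𝓘(ℝ, E) ξ.proj η.proj u))) := by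
  obtain ⟨y, p⟩ := η
  obtain ⟨q, rfl⟩ : ∃ q, p = cosy ξ.proj y q := ⟨_, (cosy_comp hη p).symm⟩
  have hy : y ∈ (chartAt E ξ.proj).source := hη
  let c : M → CoBundle E M := fun z ↦ ⟨z, cosy ξ.proj z q⟩
  have hc : MDifferentiableAt 𝓘(ℝ, E) (coModel E) c y := mdifferentiableAt_cosy hy q
  have h := tco_mvfderiv (I := coModel E) (I' := 𝓘(ℝ, E)) (x := ξ) (c := c) (z := y)
    (mem_chartAt_cotangent_source.2 hη) hc u
  have h1 : mvfderiv 𝓘(ℝ, E) (fun z ↦ extChartAt (coModel E) ξ (c z)) y u =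
      (tco 𝓘(ℝ, E) ξ.proj y u, 0) := by
    have he : (fun e ↦ extChartAt (coModel E) ξ (c ((extChartAt 𝓘(ℝ, E) ξ.proj).symm e)))
        =ᶠ[𝓝 (extChartAt 𝓘(ℝ, E) ξ.proj y)] fun e ↦ (e, q) := by
      filter_upwards [extChartAt_target_mem_nhds' ((extChartAt 𝓘(ℝ, E) ξ.proj).map_source
        (by simpa using hy))] with e he
      rw [extChartAt_cotangent]
      exact Prod.ext ((extChartAt 𝓘(ℝ, E) ξ.proj).right_inv he)
        (cosy_comp_tsy (mem_chartAt_source_symm he) q)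
    have hd := (hasFDerivAt_id (𝕜 := ℝ) (extChartAt 𝓘(ℝ, E) ξ.proj y)).prodMk
      (hasFDerivAt_const q (extChartAt 𝓘(ℝ, E) ξ.proj y))
    have hd' := hd.congr_of_eventuallyEq he
    rw [mvfderiv_eq_fderiv hy ((mdifferentiableAt_iff_comp_symm hy _).2 hd'.differentiableAt),
      hd'.fderiv]
    rfl
  -- In the chart at its own point the section has fibre derivative `∂_u θ`, which is `D_u θ` plus
  -- the Christoffel term; the latter is the fibre component of the horizontal lift.
  have h2 : (mvfderiv 𝓘(ℝ, E) (fun z ↦ extChartAt (coModel E) (c y) (c z)) y u : E × (E →L[ℝ] ℝ)) =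
      hlift D (c y) u + vlift (c y) (covForm D (fun z ↦ cosy ξ.proj z q) y u) := by
    have he : (fun e ↦ extChartAt (coModel E) (c y) (c ((extChartAt 𝓘(ℝ, E) y).symm e)))
        =ᶠ[𝓝 (extChartAt 𝓘(ℝ, E) y y)] fun e ↦ (e, corep y (fun z ↦ cosy ξ.proj z q) e) := by
      filter_upwards [extChartAt_target_mem_nhds (I := 𝓘(ℝ, E)) y] with e he
      rw [extChartAt_cotangent]
      exact Prod.ext ((extChartAt 𝓘(ℝ, E) y).right_inv he) rfl
    have hd := (hasFDerivAt_id (𝕜 := ℝ) (extChartAt 𝓘(ℝ, E) y y)).prodMk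
      (differentiableAt_corep hc).hasFDerivAt
    have hd' := hd.congr_of_eventuallyEq he
    rw [mvfderiv_eq_fderiv (mem_chart_source E y)
      ((mdifferentiableAt_iff_comp_symm (mem_chart_source E y) _).2 hd'.differentiableAt),
      hd'.fderiv, tco_self]
    have h3 := covForm_apply D hc u
    refine Prod.ext (add_zero _).symm ?_
    exact ((add_sub_cancel _ _).symm.trans (congrArg _ h3.symm))
  have h4 := (congrArg (tco (coModel E) ξ (c y)) h2).symm.trans (h.trans h1)
  rw [map_add, tco_vlift hη, covForm_cosy hD hη] at h4
  rw [cosy_comp_tsy hη]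
  refine (eq_sub_of_add_eq h4).trans ?_
  refine Prod.ext (sub_zero _) ?_
  exact (zero_sub _).trans (neg_neg _)

end Cotangent
-- Differentiability and brackets of lifts
section Lifts

variable {E : Type*} [NormedAddCommGroup E] [NormedSpace ℝ E] [FiniteDimensional ℝ E]
  {M : Type*} [TopologicalSpace M] [ChartedSpace E M] [IsManifold 𝓘(ℝ, E) ∞ M]
  {g : Metric E M} {D : Conn E M}

omit [FiniteDimensional ℝ E] in
theorem exists_extChartAt_eq {ξ : CoBundle E M} {z : E × (E →L[ℝ] ℝ)}
    (hz : z ∈ (extChartAt (coModel E) ξ).target) :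
    ∃ η : CoBundle E M, η.proj ∈ (chartAt E ξ.proj).source ∧ (extChartAt (coModel E) ξ).symm z = η ∧
      extChartAt (coModel E) ξ η = z := by
  refine ⟨(extChartAt (coModel E) ξ).symm z, ?_, rfl, (extChartAt (coModel E) ξ).right_inv hz⟩
  have h := (extChartAt (coModel E) ξ).map_target hz
  rw [extChartAt_source] at h
  exact mem_chartAt_cotangent_source.1 h

/-- The components of the covector `p` of a point `ξ = ⟨x, p⟩` in the chart at `x`. -/
def cofiber (ξ : CoBundle E M) : E →L[ℝ] ℝ := ξ.snd

omit [FiniteDimensional ℝ E] in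
theorem extChartAt_cotangent_self (ξ : CoBundle E M) :
    extChartAt (coModel E) ξ ξ = (extChartAt 𝓘(ℝ, E) ξ.proj ξ.proj, cofiber ξ) := by
  rw [extChartAt_cotangent]
  refine congrArg (fun a : E →L[ℝ] ℝ ↦ (extChartAt 𝓘(ℝ, E) ξ.proj ξ.proj, a)) ?_
  exact ContinuousLinearMap.ext fun v ↦ congrArg ξ.snd (tsy_self (I := 𝓘(ℝ, E)) ξ.proj v)

theorem rep_hliftField (hD : IsLeviCivita (fun x u v ↦ g.inner x u v) D) {ξ : CoBundle E M}
    (X : ∀ x : M, TangentSpace 𝓘(ℝ, E) x) {z : E × (E →L[ℝ] ℝ)}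
    (hz : z ∈ (extChartAt (coModel E) ξ).target) :
    rep ξ (hliftField D X) z = hrep (christoffelRep D ξ.proj) (rep ξ.proj X) z := by
  obtain ⟨η, hη, h, rfl⟩ := exists_extChartAt_eq hz
  rw [rep_extChartAt (mem_chartAt_cotangent_source.2 hη)]
  refine (tco_hlift hD hη (X η.proj)).trans ?_
  rw [← rep_extChartAt hη X, extChartAt_cotangent]
  rfl

omit [FiniteDimensional ℝ E] in
theorem rep_vliftForm {ξ : CoBundle E M} (θ : ∀ x : M, CoTan E x) {z : E × (E →L[ℝ] ℝ)}
    (hz : z ∈ (extChartAt (coModel E) ξ).target) :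
    rep ξ (vliftForm θ) z = vrep (corep ξ.proj θ) z := by
  obtain ⟨η, hη, h, rfl⟩ := exists_extChartAt_eq hz
  rw [rep_extChartAt (mem_chartAt_cotangent_source.2 hη)]
  refine (tco_vlift hη (θ η.proj)).trans ?_
  rw [extChartAt_cotangent]
  refine congrArg (fun a : E →L[ℝ] ℝ ↦ ((0 : E), a)) ?_
  change _ = corep ξ.proj θ (extChartAt 𝓘(ℝ, E) ξ.proj η.proj)
  rw [corep, (extChartAt 𝓘(ℝ, E) ξ.proj).left_inv (by simpa using hη)]

theorem J_eq_sub (D : Conn E M) (η : CoBundle E M) (ζ : CoTangent η) :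
    J D η ζ = ζ - (2 : ℝ) • hlift D η (hpart η ζ) := by
  obtain ⟨u, a⟩ : E × (E →L[ℝ] ℝ) := ζ
  refine Prod.ext ?_ rfl
  change -u = u - (2 : ℝ) • u
  module

theorem rep_J (hD : IsLeviCivita (fun x u v ↦ g.inner x u v) D) {ξ : CoBundle E M}
    (Y : ∀ η : CoBundle E M, CoTangent η) {z : E × (E →L[ℝ] ℝ)}
    (hz : z ∈ (extChartAt (coModel E) ξ).target) :
    rep ξ (fun η ↦ J D η (Y η)) z = rep ξ Y z -
      (2 : ℝ) • ((rep ξ Y z).1, z.2.comp (christoffelRep D ξ.proj z.1 (rep ξ Y z).1)) := by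
  obtain ⟨η, hη, h, rfl⟩ := exists_extChartAt_eq hz
  have hη' := mem_chartAt_cotangent_source.2 hη
  rw [rep_extChartAt hη', rep_extChartAt hη']
  have h1 := J_eq_sub D η (Y η)
  have h2 : (tco (coModel E) ξ η (Y η)).1 = tco 𝓘(ℝ, E) ξ.proj η.proj (hpart η (Y η)) := by
    conv_lhs => rw [← hlift_add_vlift D η (Y η)]
    rw [map_add, tco_hlift hD hη, tco_vlift hη]
    exact add_zero _
  rw [h1, map_sub, map_smul, tco_hlift hD hη, h2, extChartAt_cotangent]

theorem differentiableAt_christoffelRep (hD : IsLeviCivita (fun x u v ↦ g.inner x u v) D) (x : M) :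
    DifferentiableAt ℝ (christoffelRep D x) (extChartAt 𝓘(ℝ, E) x x) :=
  (isChristoffelOn hD x).differentiableAt_christoffel (mem_extChartAt_target x)

theorem mdifferentiableAt_hliftField (hD : IsLeviCivita (fun x u v ↦ g.inner x u v) D)
    {ξ : CoBundle E M} {X : ∀ x : M, TangentSpace 𝓘(ℝ, E) x}
    (hX : MDifferentiableAt 𝓘(ℝ, E) 𝓘(ℝ, E).tangent
      (fun z ↦ (⟨z, X z⟩ : TangentBundle 𝓘(ℝ, E) M)) ξ.proj) :
    MDifferentiableAt (coModel E) (coModel E).tangent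
      (fun z ↦ (⟨z, hliftField D X z⟩ : TangentBundle (coModel E) (CoBundle E M))) ξ := by
  rw [mdifferentiableAt_section_iff]
  have hX' := (mdifferentiableAt_section_iff ξ.proj X).1 hX
  have h : rep ξ (hliftField D X) =ᶠ[𝓝 (extChartAt (coModel E) ξ ξ)]
      hrep (christoffelRep D ξ.proj) (rep ξ.proj X) := by
    filter_upwards [extChartAt_target_mem_nhds (I := coModel E) ξ] with z hz
    exact rep_hliftField hD X hz
  refine DifferentiableAt.congr_of_eventuallyEq ?_ h
  rw [extChartAt_cotangent_self]
  exact (hasFDerivAt_hrep (differentiableAt_christoffelRep hD _) hX').1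

omit [FiniteDimensional ℝ E] in
theorem mdifferentiableAt_vliftForm {ξ : CoBundle E M} {θ : ∀ x : M, CoTan E x}
    (hθ : MDifferentiableAt 𝓘(ℝ, E) (coModel E) (fun z ↦ (⟨z, θ z⟩ : CoBundle E M)) ξ.proj) :
    MDifferentiableAt (coModel E) (coModel E).tangent
      (fun z ↦ (⟨z, vliftForm θ z⟩ : TangentBundle (coModel E) (CoBundle E M))) ξ := by
  rw [mdifferentiableAt_section_iff]
  have h : rep ξ (vliftForm θ) =ᶠ[𝓝 (extChartAt (coModel E) ξ ξ)] vrep (corep ξ.proj θ) := by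
    filter_upwards [extChartAt_target_mem_nhds (I := coModel E) ξ] with z hz
    exact rep_vliftForm θ hz
  refine DifferentiableAt.congr_of_eventuallyEq ?_ h
  rw [extChartAt_cotangent_self]
  exact (hasFDerivAt_vrep (differentiableAt_corep hθ)).1

/-- The conjugate connection differentiates `J Y`, so the rules for `Dt` apply only if `J Y` is
differentiable. The coefficients of `J` involve the Christoffel symbols, whose differentiability
enters here. -/
theorem mdifferentiableAt_J (hD : IsLeviCivita (fun x u v ↦ g.inner x u v) D) {ξ : CoBundle E M}
    {Y : ∀ η : CoBundle E M, CoTangent η}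
    (hY : MDifferentiableAt (coModel E) (coModel E).tangent
      (fun z ↦ (⟨z, Y z⟩ : TangentBundle (coModel E) (CoBundle E M))) ξ) :
    MDifferentiableAt (coModel E) (coModel E).tangent
      (fun z ↦ (⟨z, J D z (Y z)⟩ : TangentBundle (coModel E) (CoBundle E M))) ξ := by
  refine (mdifferentiableAt_section_iff ξ (fun η ↦ J D η (Y η))).2 ?_
  have hY' := (mdifferentiableAt_section_iff ξ Y).1 hY
  refine DifferentiableAt.congr_of_eventuallyEq (f := fun z ↦ rep ξ Y z -
      (2 : ℝ) • ((rep ξ Y z).1, z.2.comp (christoffelRep D ξ.proj z.1 (rep ξ Y z).1))) ?_ ?_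
  · have hΓ : DifferentiableAt ℝ (fun z : E × (E →L[ℝ] ℝ) ↦ christoffelRep D ξ.proj z.1)
        (extChartAt (coModel E) ξ ξ) := by
      rw [extChartAt_cotangent_self]
      exact DifferentiableAt.comp (g := christoffelRep D ξ.proj) _
        (differentiableAt_christoffelRep hD ξ.proj) differentiableAt_fst
    exact hY'.sub (((hY'.fst).prodMk (differentiableAt_snd.clm_comp
      (hΓ.clm_apply hY'.fst))).fun_const_smul (2 : ℝ))
  · filter_upwards [extChartAt_target_mem_nhds (I := coModel E) ξ] with z hz
    exact rep_J hD Y hz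

theorem christoffelForm_eq (ξ : CoBundle E M) (u : E) :
    christoffelForm D ξ u = (cofiber ξ).comp
      (christoffelRep D ξ.proj (extChartAt 𝓘(ℝ, E) ξ.proj ξ.proj) u) := by
  rw [← christoffel_eq_christoffelRep]
  rfl

theorem fderiv_rep_hliftField (hD : IsLeviCivita (fun x u v ↦ g.inner x u v) D)
    (ξ : CoBundle E M) (X : ∀ x : M, TangentSpace 𝓘(ℝ, E) x) :
    fderiv ℝ (rep ξ (hliftField D X)) (extChartAt (coModel E) ξ ξ) =
      fderiv ℝ (hrep (christoffelRep D ξ.proj) (rep ξ.proj X))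
        (extChartAt 𝓘(ℝ, E) ξ.proj ξ.proj, cofiber ξ) ∧
    (hliftField D X ξ : E × (E →L[ℝ] ℝ)) = hrep (christoffelRep D ξ.proj) (rep ξ.proj X)
      (extChartAt 𝓘(ℝ, E) ξ.proj ξ.proj, cofiber ξ) := by
  rw [← extChartAt_cotangent_self ξ]
  constructor
  · refine Filter.EventuallyEq.fderiv_eq ?_
    filter_upwards [extChartAt_target_mem_nhds (I := coModel E) ξ] with z hz
    exact rep_hliftField hD X hz
  · rw [← rep_hliftField hD X (mem_extChartAt_target ξ), rep_self]

omit [FiniteDimensional ℝ E] in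
theorem fderiv_rep_vliftForm (ξ : CoBundle E M) (θ : ∀ x : M, CoTan E x) :
    fderiv ℝ (rep ξ (vliftForm θ)) (extChartAt (coModel E) ξ ξ) =
      fderiv ℝ (vrep (corep ξ.proj θ)) (extChartAt 𝓘(ℝ, E) ξ.proj ξ.proj, cofiber ξ) ∧
    (vliftForm θ ξ : E × (E →L[ℝ] ℝ)) = vrep (corep ξ.proj θ)
      (extChartAt 𝓘(ℝ, E) ξ.proj ξ.proj, cofiber ξ) := by
  rw [← extChartAt_cotangent_self ξ]
  constructor
  · refine Filter.EventuallyEq.fderiv_eq ?_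
    filter_upwards [extChartAt_target_mem_nhds (I := coModel E) ξ] with z hz
    exact rep_vliftForm θ hz
  · rw [← rep_vliftForm θ (mem_extChartAt_target ξ), rep_self]

/-- The vertical part measures the failure of the horizontal distribution to be integrable. It comes
from `bracket_hrep_hrep`, with the local expression identified by `curvature_apply`. -/
theorem mlieBracket_hliftField_hliftField (hD : IsLeviCivita (fun x u v ↦ g.inner x u v) D)
    (ξ : CoBundle E M) {X Y : ∀ x : M, TangentSpace 𝓘(ℝ, E) x}
    (hX : MDifferentiableAt 𝓘(ℝ, E) 𝓘(ℝ, E).tangent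
      (fun z ↦ (⟨z, X z⟩ : TangentBundle 𝓘(ℝ, E) M)) ξ.proj)
    (hY : MDifferentiableAt 𝓘(ℝ, E) 𝓘(ℝ, E).tangent
      (fun z ↦ (⟨z, Y z⟩ : TangentBundle 𝓘(ℝ, E) M)) ξ.proj) :
    VectorField.mlieBracket (coModel E) (hliftField D X) (hliftField D Y) ξ =
      hlift D ξ (VectorField.mlieBracket 𝓘(ℝ, E) X Y ξ.proj) +
        vlift ξ (pR D ξ (X ξ.proj) (Y ξ.proj)) := by
  have : CompleteSpace E := FiniteDimensional.complete ℝ E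
  have hX' := (mdifferentiableAt_section_iff ξ.proj X).1 hX
  have hY' := (mdifferentiableAt_section_iff ξ.proj Y).1 hY
  obtain ⟨hX1, hX2⟩ := fderiv_rep_hliftField hD ξ X
  obtain ⟨hY1, hY2⟩ := fderiv_rep_hliftField hD ξ Y
  rw [mlieBracket_eq, hX1, hY1, hX2, hY2, mlieBracket_eq]
  refine (bracket_hrep_hrep (differentiableAt_christoffelRep hD _) hX' hY').trans ?_
  refine congrArg₂ (fun a b : E × (E →L[ℝ] ℝ) ↦ a + b) ?_ ?_
  · have aux (v w : E) (h : v = w) :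
        ((v, (cofiber ξ).comp (christoffelRep D ξ.proj (extChartAt 𝓘(ℝ, E) ξ.proj ξ.proj) v)) :
          E × (E →L[ℝ] ℝ)) = hlift D ξ w := by
      rw [← christoffelForm_eq, h]
      rfl
    refine aux _ _ ?_
    dsimp only
    rw [rep_self, rep_self]
  · dsimp only
    refine congrArg (fun A : E →L[ℝ] E ↦ ((0 : E), (cofiber ξ).comp A)) ?_
    refine (curvature_apply hD ξ.proj _ _).symm.trans ?_
    exact congrArg₂ (fun v w : E ↦ curvature D ξ.proj v w) (rep_self ξ.proj X) (rep_self ξ.proj Y)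

theorem mlieBracket_hliftField_vliftForm (hD : IsLeviCivita (fun x u v ↦ g.inner x u v) D)
    (ξ : CoBundle E M) {X : ∀ x : M, TangentSpace 𝓘(ℝ, E) x} {θ : ∀ x : M, CoTan E x}
    (hX : MDifferentiableAt 𝓘(ℝ, E) 𝓘(ℝ, E).tangent
      (fun z ↦ (⟨z, X z⟩ : TangentBundle 𝓘(ℝ, E) M)) ξ.proj)
    (hθ : MDifferentiableAt 𝓘(ℝ, E) (coModel E) (fun z ↦ (⟨z, θ z⟩ : CoBundle E M)) ξ.proj) :
    VectorField.mlieBracket (coModel E) (hliftField D X) (vliftForm θ) ξ =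
      vlift ξ (covForm D θ ξ.proj (X ξ.proj)) := by
  have : CompleteSpace E := FiniteDimensional.complete ℝ E
  have hX' := (mdifferentiableAt_section_iff ξ.proj X).1 hX
  obtain ⟨hX1, hX2⟩ := fderiv_rep_hliftField hD ξ X
  obtain ⟨hθ1, hθ2⟩ := fderiv_rep_vliftForm ξ θ
  rw [mlieBracket_eq, hX1, hX2, hθ1, hθ2]
  refine (bracket_hrep_vrep (differentiableAt_christoffelRep hD _) hX'
    (differentiableAt_corep hθ)).trans ?_
  refine congrArg (fun a : E →L[ℝ] ℝ ↦ ((0 : E), a)) ?_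
  have aux (v w : E) (p q : E →L[ℝ] ℝ) (h : v = w) (h' : p = q) :
      fderiv ℝ (corep ξ.proj θ) (extChartAt 𝓘(ℝ, E) ξ.proj ξ.proj) v -
        p.comp (christoffelRep D ξ.proj (extChartAt 𝓘(ℝ, E) ξ.proj ξ.proj) v) =
      fderiv ℝ (corep ξ.proj θ) (extChartAt 𝓘(ℝ, E) ξ.proj ξ.proj) w -
        q.comp (christoffel D ξ.proj w) := by
    rw [h, h', christoffel_eq_christoffelRep]
  exact (aux _ _ _ _ (rep_self ξ.proj X) (corep_self ξ.proj θ)).trans (covForm_apply D hθ _).symm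

theorem mlieBracket_vliftForm_vliftForm (ξ : CoBundle E M) {β θ : ∀ x : M, CoTan E x}
    (hβ : MDifferentiableAt 𝓘(ℝ, E) (coModel E) (fun z ↦ (⟨z, β z⟩ : CoBundle E M)) ξ.proj)
    (hθ : MDifferentiableAt 𝓘(ℝ, E) (coModel E) (fun z ↦ (⟨z, θ z⟩ : CoBundle E M)) ξ.proj) :
    VectorField.mlieBracket (coModel E) (vliftForm β) (vliftForm θ) ξ = 0 := by
  have : CompleteSpace E := FiniteDimensional.complete ℝ E
  obtain ⟨hβ1, hβ2⟩ := fderiv_rep_vliftForm ξ β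
  obtain ⟨hθ1, hθ2⟩ := fderiv_rep_vliftForm ξ θ
  rw [mlieBracket_eq, hβ1, hβ2, hθ1, hθ2,
    (hasFDerivAt_vrep (z := (extChartAt 𝓘(ℝ, E) ξ.proj ξ.proj, cofiber ξ))
      (differentiableAt_corep hβ)).2,
    (hasFDerivAt_vrep (z := (extChartAt 𝓘(ℝ, E) ξ.proj ξ.proj, cofiber ξ))
      (differentiableAt_corep hθ)).2]
  simp only [vrep, map_zero, sub_self]
  rfl

end Lifts
-- Algebra of the Cheeger–Gromoll metric at a point
section InnerProduct

variable {E : Type*} [NormedAddCommGroup E] [NormedSpace ℝ E] [FiniteDimensional ℝ E]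
  {M : Type*} [TopologicalSpace M] [ChartedSpace E M] [IsManifold 𝓘(ℝ, E) ∞ M]
  (g : Metric E M)

theorem coInner_eq_inner (x : M) (β θ : CoTan E x) :
    coInner g x β θ = g.inner x (sharp g x β) (sharp g x θ) :=
  (inner_sharp g x β _).symm

theorem coInner_comm (x : M) (β θ : CoTan E x) : coInner g x β θ = coInner g x θ β := by
  rw [coInner_eq_inner, coInner_eq_inner, g.symm]

theorem coInner_sub_left (x : M) (β β' θ : CoTan E x) :
    coInner g x (β - β') θ = coInner g x β θ - coInner g x β' θ := rfl

theorem coInner_smul_left (x : M) (c : ℝ) (β θ : CoTan E x) :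
    coInner g x (c • β) θ = c * coInner g x β θ := rfl

theorem coInner_zero_left (x : M) (θ : CoTan E x) : coInner g x 0 θ = 0 := rfl

omit [FiniteDimensional ℝ E] in
theorem inner_self_nonneg (x : M) (v : TangentSpace 𝓘(ℝ, E) x) : 0 ≤ g.inner x v v := by
  by_cases h : v = 0
  · rw [h, map_zero]
  · exact (g.pos x v h).le

theorem coInner_self_nonneg (x : M) (β : CoTan E x) : 0 ≤ coInner g x β β := by
  rw [coInner_eq_inner]
  exact inner_self_nonneg g x _

theorem eq_zero_of_coInner_self (x : M) {β : CoTan E x} (h : coInner g x β β = 0) : β = 0 := by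
  by_contra hne
  rw [coInner_eq_inner] at h
  refine (g.pos x (sharp g x β) fun h0 ↦ hne ?_).ne' h
  refine ContinuousLinearMap.ext fun w ↦ ?_
  rw [← inner_sharp g x β w, h0, map_zero]

theorem alpha_pos (ξ : CoBundle E M) : 0 < alpha g ξ :=
  add_pos_of_pos_of_nonneg one_pos (coInner_self_nonneg g _ _)

variable (f : M → ℝ) (D : Conn E M)

theorem cgMetric_comm (ξ : CoBundle E M) (ζ η : CoTangent ξ) :
    cgMetric g f D ξ ζ η = cgMetric g f D ξ η ζ := by
  rw [cgMetric, cgMetric, g.symm, coInner_comm g ξ.proj (vpart D ξ ζ) (vpart D ξ η)]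
  ring

omit [FiniteDimensional ℝ E] in
theorem hpart_sub (ξ : CoBundle E M) (ζ η : CoTangent ξ) :
    hpart ξ (ζ - η) = hpart ξ ζ - hpart ξ η := rfl

theorem vpart_sub (ξ : CoBundle E M) (ζ η : CoTangent ξ) :
    vpart D ξ (ζ - η) = vpart D ξ ζ - vpart D ξ η := by
  have aux (a b : E →L[ℝ] ℝ) (u v : E) : (a - b) - christoffelForm D ξ (u - v) =
      (a - christoffelForm D ξ u) - (b - christoffelForm D ξ v) := by
    rw [map_sub]
    abel
  exact aux (ζ : E × (E →L[ℝ] ℝ)).2 (η : E × (E →L[ℝ] ℝ)).2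
    (ζ : E × (E →L[ℝ] ℝ)).1 (η : E × (E →L[ℝ] ℝ)).1

theorem cgMetric_sub_left (ξ : CoBundle E M) (ζ ζ' η : CoTangent ξ) :
    cgMetric g f D ξ (ζ - ζ') η = cgMetric g f D ξ ζ η - cgMetric g f D ξ ζ' η := by
  rw [cgMetric, cgMetric, cgMetric, hpart_sub, vpart_sub, coInner_sub_left, coInner_sub_left,
    map_sub, _root_.sub_apply]
  ring

theorem cgMetric_hlift (ξ : CoBundle E M) (ζ : CoTangent ξ) (v : TangentSpace 𝓘(ℝ, E) ξ.proj) :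
    cgMetric g f D ξ ζ (hlift D ξ v) = f ξ.proj * g.inner ξ.proj (hpart ξ ζ) v := by
  rw [cgMetric, hpart_hlift, vpart_hlift, coInner_zero_left,
    coInner_comm g ξ.proj (vpart D ξ ζ) 0, coInner_zero_left]
  ring

theorem cgMetric_vlift (ξ : CoBundle E M) (ζ : CoTangent ξ) (θ : CoTan E ξ.proj) :
    cgMetric g f D ξ ζ (vlift ξ θ) = (1 / alpha g ξ) *
      (coInner g ξ.proj (vpart D ξ ζ) θ +
        coInner g ξ.proj (vpart D ξ ζ) ξ.snd * coInner g ξ.proj θ ξ.snd) := by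
  rw [cgMetric, hpart_vlift, vpart_vlift, map_zero]
  ring

theorem cgMetric_hlift_vlift (ξ : CoBundle E M) (v : TangentSpace 𝓘(ℝ, E) ξ.proj)
    (θ : CoTan E ξ.proj) : cgMetric g f D ξ (hlift D ξ v) (vlift ξ θ) = 0 := by
  rw [cgMetric_comm, cgMetric_vlift_hlift]

variable {f}

omit [FiniteDimensional ℝ E] in
theorem eq_of_inner {x : M} {u v : TangentSpace 𝓘(ℝ, E) x}
    (h : ∀ w, g.inner x u w = g.inner x v w) : u = v := by
  by_contra hne
  refine (g.pos x (u - v) (sub_ne_zero.2 hne)).ne' ?_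
  have h' := h (u - v)
  rw [← sub_eq_zero] at h'
  exact (congrArg (fun l : TangentSpace 𝓘(ℝ, E) x →L[ℝ] ℝ ↦ l (u - v))
    (map_sub (g.inner x) u v)).trans h'

/-- A vector of `T*M` is determined by its products with lifts. -/
theorem eq_of_cgMetric {ξ : CoBundle E M} (hf : 0 < f ξ.proj) {ζ : CoTangent ξ}
    {u : TangentSpace 𝓘(ℝ, E) ξ.proj} {β : CoTan E ξ.proj}
    (hu : ∀ w, cgMetric g f D ξ ζ (hlift D ξ w) = f ξ.proj * g.inner ξ.proj u w)
    (hβ : ∀ μ, cgMetric g f D ξ ζ (vlift ξ μ) = (1 / alpha g ξ) *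
      (coInner g ξ.proj β μ + coInner g ξ.proj β ξ.snd * coInner g ξ.proj μ ξ.snd)) :
    ζ = hlift D ξ u + vlift ξ β := by
  have h1 : hpart ξ ζ = u := by
    refine eq_of_inner g fun w ↦ ?_
    have := hu w
    rw [cgMetric_hlift] at this
    exact mul_left_cancel₀ hf.ne' this
  have h2 : vpart D ξ ζ = β := by
    rw [← sub_eq_zero]
    refine eq_zero_of_coInner_self g ξ.proj ?_
    -- Tested on the difference `γ` of the two covectors, the hypothesis gives `g⁻¹(γ, γ) + g⁻¹(γ,
    -- p)² = 0`, a vanishing sum of nonnegative terms.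
    have := hβ (vpart D ξ ζ - β)
    rw [cgMetric_vlift] at this
    have h3 := mul_left_cancel₀ (one_div_pos.2 (alpha_pos g ξ)).ne' this
    have h4 : coInner g ξ.proj (vpart D ξ ζ - β) (vpart D ξ ζ - β) +
        coInner g ξ.proj (vpart D ξ ζ - β) ξ.snd ^ 2 = 0 := by
      rw [coInner_sub_left g ξ.proj _ _ (vpart D ξ ζ - β)]
      rw [coInner_sub_left g ξ.proj _ _ ξ.snd] at h3 ⊢
      linear_combination h3
    nlinarith [coInner_self_nonneg g ξ.proj (vpart D ξ ζ - β),
      sq_nonneg (coInner g ξ.proj (vpart D ξ ζ - β) ξ.snd)]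
  rw [← h1, ← h2, hlift_add_vlift]

end InnerProduct

/-! ### Covariant derivatives along the cotangent bundle and derivatives of the metric -/

section Derivatives

variable {E : Type*} [NormedAddCommGroup E] [NormedSpace ℝ E] [FiniteDimensional ℝ E]
  {M : Type*} [TopologicalSpace M] [ChartedSpace E M] [IsManifold 𝓘(ℝ, E) ∞ M]
  {g : Metric E M} {D : Conn E M}

/-- The components of a field of covectors of `M` along `T*M`, in the chart at `ξ`. -/
def alongRep (ξ : CoBundle E M) (α : ∀ η : CoBundle E M, CoTan E η.proj) (z : E × (E →L[ℝ] ℝ)) :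
    E →L[ℝ] ℝ :=
  (α ((extChartAt (coModel E) ξ).symm z)).comp
    (tsy 𝓘(ℝ, E) ξ.proj ((extChartAt (coModel E) ξ).symm z).proj)

omit [FiniteDimensional ℝ E] in
theorem alongRep_self (ξ : CoBundle E M) (α : ∀ η : CoBundle E M, CoTan E η.proj) :
    alongRep ξ α (extChartAt (coModel E) ξ ξ) = α ξ := by
  rw [alongRep, extChartAt_to_inv]
  exact ContinuousLinearMap.ext fun v ↦ congrArg (α ξ) (tsy_self (I := 𝓘(ℝ, E)) ξ.proj v)

/-- The field `α` of covectors of `M` along `T*M` has the covariant derivative `A ζ` at `ξ` in the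
direction of `ζ`. -/
def HasCovDerivAt (D : Conn E M) (α : ∀ η : CoBundle E M, CoTan E η.proj) (ξ : CoBundle E M)
    (A : CoTangent ξ → CoTan E ξ.proj) : Prop :=
  ∃ a' : E × (E →L[ℝ] ℝ) →L[ℝ] E →L[ℝ] ℝ,
    HasFDerivAt (alongRep ξ α) a' (extChartAt (coModel E) ξ ξ) ∧
    ∀ ζ : E × (E →L[ℝ] ℝ), A ζ = a' ζ - (alongRep ξ α (extChartAt (coModel E) ξ ξ)).comp
      (christoffelRep D ξ.proj (extChartAt (coModel E) ξ ξ).1 ζ.1)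

theorem hasCovDerivAt_form {ξ : CoBundle E M} {θ : ∀ x : M, CoTan E x}
    (hθ : MDifferentiableAt 𝓘(ℝ, E) (coModel E) (fun z ↦ (⟨z, θ z⟩ : CoBundle E M)) ξ.proj) :
    HasCovDerivAt D (fun η ↦ θ η.proj) ξ (fun ζ ↦ covForm D θ ξ.proj (hpart ξ ζ)) := by
  have h1 : alongRep ξ (fun η ↦ θ η.proj) =ᶠ[𝓝 (extChartAt (coModel E) ξ ξ)]
      fun z ↦ corep ξ.proj θ z.1 := by
    filter_upwards [extChartAt_target_mem_nhds (I := coModel E) ξ] with z hz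
    obtain ⟨η, hη, h, rfl⟩ := exists_extChartAt_eq hz
    rw [alongRep, h, extChartAt_cotangent]
    change _ = corep ξ.proj θ (extChartAt 𝓘(ℝ, E) ξ.proj η.proj)
    rw [corep, (extChartAt 𝓘(ℝ, E) ξ.proj).left_inv (by simpa using hη)]
  have h2 : HasFDerivAt (fun z : E × (E →L[ℝ] ℝ) ↦ corep ξ.proj θ z.1)
      ((fderiv ℝ (corep ξ.proj θ) (extChartAt (coModel E) ξ ξ).1).comp
        (ContinuousLinearMap.fst ℝ E (E →L[ℝ] ℝ))) (extChartAt (coModel E) ξ ξ) := by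
    refine HasFDerivAt.comp (g := corep ξ.proj θ) (extChartAt (coModel E) ξ ξ) ?_ hasFDerivAt_fst
    rw [extChartAt_cotangent_self]
    exact (differentiableAt_corep hθ).hasFDerivAt
  refine ⟨_, h2.congr_of_eventuallyEq h1, fun ζ ↦ ?_⟩
  refine (covForm_apply D hθ ζ.1).trans ?_
  rw [alongRep_self, extChartAt_cotangent_self, christoffel_eq_christoffelRep]
  rfl

/-- In the induced chart `p` is the second coordinate, so its derivative along `ζ` is the fibre
component of `ζ`; subtracting the Christoffel term leaves the vertical part. Thus `p` is parallel in
horizontal directions. -/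
theorem hasCovDerivAt_snd (ξ : CoBundle E M) :
    HasCovDerivAt D (fun η ↦ η.snd) ξ (vpart D ξ) := by
  have h1 : alongRep ξ (fun η ↦ η.snd) =ᶠ[𝓝 (extChartAt (coModel E) ξ ξ)] fun z ↦ z.2 := by
    filter_upwards [extChartAt_target_mem_nhds (I := coModel E) ξ] with z hz
    obtain ⟨η, hη, h, rfl⟩ := exists_extChartAt_eq hz
    rw [alongRep, h, extChartAt_cotangent]
  refine ⟨_, hasFDerivAt_snd.congr_of_eventuallyEq h1, fun ζ ↦ ?_⟩
  rw [alongRep_self, extChartAt_cotangent_self]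
  refine (congrArg (fun a : E →L[ℝ] ℝ ↦ ζ.2 - a) (christoffelForm_eq ξ ζ.1)).trans ?_
  rfl

theorem coInner_self_eq (hD : IsLeviCivita (fun x u v ↦ g.inner x u v) D) (x : M)
    (β θ : E →L[ℝ] ℝ) :
    coInner g x β θ = β ((metricRep g x (extChartAt 𝓘(ℝ, E) x x)).inverse θ) := by
  have h (β : E →L[ℝ] ℝ) : β.comp (tsy 𝓘(ℝ, E) x x) = β :=
    ContinuousLinearMap.ext fun v ↦ congrArg β (tsy_self (I := 𝓘(ℝ, E)) x v)
  refine (coInner_eq hD (mem_chart_source E x) β θ).trans ?_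
  exact congrArg₂ (fun a b : E →L[ℝ] ℝ ↦
    a ((metricRep g x (extChartAt 𝓘(ℝ, E) x x)).inverse b)) (h β) (h θ)

/-- Since `g` is parallel, differentiating `g⁻¹` contributes precisely the Christoffel terms that
turn the derivatives of the two covectors into covariant ones. -/
theorem mvfderiv_coInner (hD : IsLeviCivita (fun x u v ↦ g.inner x u v) D) {ξ : CoBundle E M}
    {α β : ∀ η : CoBundle E M, CoTan E η.proj} {A B : CoTangent ξ → CoTan E ξ.proj}
    (hα : HasCovDerivAt D α ξ A) (hβ : HasCovDerivAt D β ξ B) :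
    MDifferentiableAt (coModel E) 𝓘(ℝ, ℝ) (fun η ↦ coInner g η.proj (α η) (β η)) ξ ∧
    ∀ ζ, mvfderiv (coModel E) (fun η ↦ coInner g η.proj (α η) (β η)) ξ ζ =
      coInner g ξ.proj (A ζ) (β ξ) + coInner g ξ.proj (B ζ) (α ξ) := by
  obtain ⟨a', ha, hA⟩ := hα
  obtain ⟨b', hb, hB⟩ := hβ
  have hz : (extChartAt (coModel E) ξ ξ).1 ∈ (extChartAt 𝓘(ℝ, E) ξ.proj).target := by
    rw [extChartAt_cotangent_self]
    exact mem_extChartAt_target ξ.proj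
  obtain ⟨h1, h2⟩ := (isChristoffelOn hD ξ.proj).hasFDerivAt_coInner hz hasFDerivAt_fst ha hb
  have h3 : (fun z ↦ coInner g ((extChartAt (coModel E) ξ).symm z).proj
        (α ((extChartAt (coModel E) ξ).symm z)) (β ((extChartAt (coModel E) ξ).symm z)))
      =ᶠ[𝓝 (extChartAt (coModel E) ξ ξ)] fun z ↦
        alongRep ξ α z ((metricRep g ξ.proj z.1).inverse (alongRep ξ β z)) := by
    filter_upwards [extChartAt_target_mem_nhds (I := coModel E) ξ] with z hz
    obtain ⟨η, hη, h, rfl⟩ := exists_extChartAt_eq hz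
    rw [alongRep, alongRep, h, coInner_eq hD hη, extChartAt_cotangent]
  have hd : MDifferentiableAt (coModel E) 𝓘(ℝ, ℝ) (fun η ↦ coInner g η.proj (α η) (β η)) ξ :=
    (mdifferentiableAt_iff_comp_symm (mem_chart_source _ ξ) _).2 (h1.congr_of_eventuallyEq h3)
  refine ⟨hd, fun ζ ↦ ?_⟩
  rw [mvfderiv_eq_fderiv (mem_chart_source _ ξ) hd, h3.fderiv_eq, tco_self]
  refine (h2 ζ).trans ?_
  have e1 := congrArg (fun a : E →L[ℝ] ℝ ↦ coInner g ξ.proj a (β ξ)) (hA ζ)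
  have e2 := congrArg (fun a : E →L[ℝ] ℝ ↦ coInner g ξ.proj a (α ξ)) (hB ζ)
  refine Eq.trans ?_ (congrArg₂ (fun s t : ℝ ↦ s + t) e1 e2).symm
  have e3 (a : E →L[ℝ] ℝ) (γ : CoTan E ξ.proj) (c : E →L[ℝ] ℝ) (h : c = γ) :
      a ((metricRep g ξ.proj (extChartAt (coModel E) ξ ξ).1).inverse c) =
        coInner g ξ.proj a γ := by
    rw [extChartAt_cotangent_self, h]
    exact (coInner_self_eq hD ξ.proj a γ).symm
  exact congrArg₂ (fun s t : ℝ ↦ s + t) (e3 _ _ _ (alongRep_self ξ β))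
    (e3 _ _ _ (alongRep_self ξ α))

omit [FiniteDimensional ℝ E] in
theorem mvfderiv_comp_proj {ξ : CoBundle E M} {F : M → ℝ}
    (hF : MDifferentiableAt 𝓘(ℝ, E) 𝓘(ℝ, ℝ) F ξ.proj) :
    MDifferentiableAt (coModel E) 𝓘(ℝ, ℝ) (fun η : CoBundle E M ↦ F η.proj) ξ ∧
    ∀ ζ, mvfderiv (coModel E) (fun η : CoBundle E M ↦ F η.proj) ξ ζ =
      mvfderiv 𝓘(ℝ, E) F ξ.proj (hpart ξ ζ) := by
  have h := (mdifferentiableAt_iff_comp_symm (mem_chart_source _ ξ.proj) _).1 hF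
  have h3 : (fun z ↦ F ((extChartAt (coModel E) ξ).symm z).proj)
      =ᶠ[𝓝 (extChartAt (coModel E) ξ ξ)] fun z ↦
        F ((extChartAt 𝓘(ℝ, E) ξ.proj).symm z.1) := by
    filter_upwards [extChartAt_target_mem_nhds (I := coModel E) ξ] with z hz
    obtain ⟨η, hη, h, rfl⟩ := exists_extChartAt_eq hz
    rw [h, extChartAt_cotangent]
    exact congrArg F ((extChartAt 𝓘(ℝ, E) ξ.proj).left_inv (by simpa using hη)).symm
  have h4 : HasFDerivAt (fun z : E × (E →L[ℝ] ℝ) ↦ F ((extChartAt 𝓘(ℝ, E) ξ.proj).symm z.1))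
      ((fderiv ℝ (fun e ↦ F ((extChartAt 𝓘(ℝ, E) ξ.proj).symm e))
        (extChartAt 𝓘(ℝ, E) ξ.proj ξ.proj)).comp (ContinuousLinearMap.fst ℝ E (E →L[ℝ] ℝ)))
      (extChartAt (coModel E) ξ ξ) := by
    refine HasFDerivAt.comp (g := fun e ↦ F ((extChartAt 𝓘(ℝ, E) ξ.proj).symm e))
      (extChartAt (coModel E) ξ ξ) ?_ hasFDerivAt_fst
    rw [extChartAt_cotangent_self]
    exact h.hasFDerivAt
  have h5 := h4.congr_of_eventuallyEq h3
  have hd : MDifferentiableAt (coModel E) 𝓘(ℝ, ℝ) (fun η : CoBundle E M ↦ F η.proj) ξ :=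
    (mdifferentiableAt_iff_comp_symm (mem_chart_source _ ξ) _).2 h5.differentiableAt
  refine ⟨hd, fun ζ ↦ ?_⟩
  rw [mvfderiv_eq_fderiv (mem_chart_source _ ξ) hd, h5.fderiv, tco_self,
    mvfderiv_eq_fderiv (mem_chart_source _ ξ.proj) hF, tco_self]
  rfl

/-- The derivative of the metric on vertical lifts of one-forms. -/
theorem mvfderiv_cgMetric_vliftForm (hD : IsLeviCivita (fun x u v ↦ g.inner x u v) D)
    (f : M → ℝ) {ξ : CoBundle E M} {β θ : ∀ x : M, CoTan E x}
    (hβ : MDifferentiableAt 𝓘(ℝ, E) (coModel E) (fun z ↦ (⟨z, β z⟩ : CoBundle E M)) ξ.proj)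
    (hθ : MDifferentiableAt 𝓘(ℝ, E) (coModel E) (fun z ↦ (⟨z, θ z⟩ : CoBundle E M)) ξ.proj)
    (ζ : CoTangent ξ) :
    alpha g ξ * mvfderiv (coModel E)
        (fun η ↦ cgMetric g f D η (vliftForm β η) (vliftForm θ η)) ξ ζ +
      cgMetric g f D ξ (vliftForm β ξ) (vliftForm θ ξ) *
        (2 * coInner g ξ.proj (vpart D ξ ζ) ξ.snd) =
      coInner g ξ.proj (covForm D β ξ.proj (hpart ξ ζ)) (θ ξ.proj) +
      coInner g ξ.proj (covForm D θ ξ.proj (hpart ξ ζ)) (β ξ.proj) +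
      coInner g ξ.proj (β ξ.proj) ξ.snd *
        (coInner g ξ.proj (covForm D θ ξ.proj (hpart ξ ζ)) ξ.snd +
          coInner g ξ.proj (vpart D ξ ζ) (θ ξ.proj)) +
      coInner g ξ.proj (θ ξ.proj) ξ.snd *
        (coInner g ξ.proj (covForm D β ξ.proj (hpart ξ ζ)) ξ.snd +
          coInner g ξ.proj (vpart D ξ ζ) (β ξ.proj)) := by
  obtain ⟨h1, h1'⟩ := mvfderiv_coInner hD (hasCovDerivAt_form hβ) (hasCovDerivAt_form hθ)
  obtain ⟨h2, h2'⟩ := mvfderiv_coInner hD (hasCovDerivAt_form hβ) (hasCovDerivAt_snd ξ)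
  obtain ⟨h3, h3'⟩ := mvfderiv_coInner hD (hasCovDerivAt_form hθ) (hasCovDerivAt_snd ξ)
  obtain ⟨h4, h4'⟩ := mvfderiv_coInner hD (hasCovDerivAt_snd (D := D) ξ) (hasCovDerivAt_snd ξ)
  have hα : MDifferentiableAt (coModel E) 𝓘(ℝ, ℝ) (fun η : CoBundle E M ↦ alpha g η) ξ :=
    mdifferentiableAt_const.add h4
  have hα' : mvfderiv (coModel E) (fun η : CoBundle E M ↦ alpha g η) ξ ζ =
      2 * coInner g ξ.proj (vpart D ξ ζ) ξ.snd := by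
    have := congrArg (fun l ↦ l ζ) (mvfderiv_fun_add (mdifferentiableAt_const (c := (1 : ℝ))) h4)
    refine this.trans ?_
    rw [_root_.add_apply, h4', mvfderiv_const, _root_.zero_apply]
    ring
  have hN := h1.add (h2.mul h3)
  have hN' := mvfderiv_fun_add h1 (h2.mul h3)
  have hq : MDifferentiableAt (coModel E) 𝓘(ℝ, ℝ)
      (fun η ↦ cgMetric g f D η (vliftForm β η) (vliftForm θ η)) ξ := by
    have e := mem_chart_source (ModelProd E (E →L[ℝ] ℝ)) ξ
    rw [mdifferentiableAt_iff_comp_symm e] at hα hN ⊢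
    refine DifferentiableAt.congr_of_eventuallyEq (((hα.inv ?_).mul hN))
      (Eventually.of_forall fun z ↦ ?_)
    · exact (alpha_pos g _).ne'
    · refine (cgMetric_vlift_vlift g f D _ _ _).trans ?_
      rw [one_div]
      rfl
  -- Multiplying by `α` clears the denominator: the right-hand side is polynomial in three pairings
  -- of covectors, and the product rule on both sides replaces a quotient rule.
  have hprod : (fun η ↦ alpha g η * cgMetric g f D η (vliftForm β η) (vliftForm θ η)) =
      fun η : CoBundle E M ↦ coInner g η.proj (β η.proj) (θ η.proj) +
        coInner g η.proj (β η.proj) η.snd * coInner g η.proj (θ η.proj) η.snd := by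
    funext η
    rw [vliftForm, vliftForm, cgMetric_vlift_vlift, ← mul_assoc,
      mul_one_div_cancel (alpha_pos g η).ne', one_mul]
  have h5 := congrArg (fun F ↦ mvfderiv (coModel E) F ξ ζ) hprod
  have h6 := congrArg (fun l ↦ l ζ) (mvfderiv_fun_mul hα hq)
  have h7 := h6.symm.trans (h5.trans (congrArg (fun l ↦ l ζ) hN'))
  have h8 := congrArg (fun l ↦ l ζ) (mvfderiv_fun_mul h2 h3)
  simp only [_root_.add_apply, _root_.smul_apply, smul_eq_mul, hα', h1'] at h7
  simp only [_root_.add_apply, _root_.smul_apply, smul_eq_mul, h2', h3'] at h8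
  refine h7.trans ?_
  refine (congrArg (fun t ↦ _ + t) h8).trans ?_
  ring

end Derivatives
-- The Levi-Civita connection of the Cheeger–Gromoll metric on lifts
section LeviCivita

variable {E : Type*} [NormedAddCommGroup E] [NormedSpace ℝ E] [FiniteDimensional ℝ E]
  {M : Type*} [TopologicalSpace M] [ChartedSpace E M] [IsManifold 𝓘(ℝ, E) ∞ M]
  {g : Metric E M} {f : M → ℝ} {D : Conn E M} {Dt : CoConn E M}

theorem hlift_smul (ξ : CoBundle E M) (c : ℝ) (u : TangentSpace 𝓘(ℝ, E) ξ.proj) :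
    hlift D ξ (c • u) = c • hlift D ξ u := by
  have aux (u : E) : ((c • u, christoffelForm D ξ (c • u)) : E × (E →L[ℝ] ℝ)) =
      c • (u, christoffelForm D ξ u) := by rw [map_smul]; rfl
  exact aux u

omit [FiniteDimensional ℝ E] in
theorem vlift_smul (ξ : CoBundle E M) (c : ℝ) (β : CoTan E ξ.proj) :
    vlift ξ (c • β) = c • vlift ξ β := by
  have aux (a : E →L[ℝ] ℝ) : ((0, c • a) : E × (E →L[ℝ] ℝ)) = c • (0, a) := by
    rw [Prod.smul_mk, smul_zero]
  exact aux β

omit [FiniteDimensional ℝ E] in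
theorem vlift_add (ξ : CoBundle E M) (β θ : CoTan E ξ.proj) :
    vlift ξ (β + θ) = vlift ξ β + vlift ξ θ := by
  have aux (a b : E →L[ℝ] ℝ) : ((0, a + b) : E × (E →L[ℝ] ℝ)) = (0, a) + (0, b) := by
    rw [Prod.mk_add_mk, add_zero]
  exact aux β θ

omit [FiniteDimensional ℝ E] in
theorem vlift_neg (ξ : CoBundle E M) (β : CoTan E ξ.proj) : vlift ξ (-β) = -vlift ξ β := by
  rw [← neg_one_smul ℝ β, vlift_smul, neg_one_smul]

theorem hpart_hlift_add_vlift (ξ : CoBundle E M) (u : TangentSpace 𝓘(ℝ, E) ξ.proj)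
    (β : CoTan E ξ.proj) : hpart ξ (hlift D ξ u + vlift ξ β) = u :=
  add_zero (u : E)

theorem vpart_hlift_add_vlift (ξ : CoBundle E M) (u : TangentSpace 𝓘(ℝ, E) ξ.proj)
    (β : CoTan E ξ.proj) : vpart D ξ (hlift D ξ u + vlift ξ β) = β := by
  have aux (u : E) (a : E →L[ℝ] ℝ) :
      christoffelForm D ξ u + a - christoffelForm D ξ (u + 0) = a := by
    rw [add_zero, add_sub_cancel_left]
  exact aux u β

theorem cgMetric_hlift_add_vlift (ξ : CoBundle E M) (u : TangentSpace 𝓘(ℝ, E) ξ.proj)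
    (β θ : CoTan E ξ.proj) : cgMetric g f D ξ (hlift D ξ u + vlift ξ β) (vlift ξ θ) =
      cgMetric g f D ξ (vlift ξ β) (vlift ξ θ) := by
  rw [cgMetric_vlift, vpart_hlift_add_vlift, cgMetric_vlift, vpart_vlift]

/-- The factor `1 + g⁻¹(p, p)` arising from the two terms of the metric is `α`, and cancels the
denominator. -/
theorem cgMetric_vlift_liouville (ξ : CoBundle E M) (β : CoTan E ξ.proj) :
    cgMetric g f D ξ (vlift ξ β) (liouville ξ) = coInner g ξ.proj β ξ.snd := by
  rw [liouville, cgMetric_vlift_vlift]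
  have h := alpha_pos g ξ
  have h' : coInner g ξ.proj ξ.snd ξ.snd = alpha g ξ - 1 := by rw [alpha]; ring
  rw [h']
  field_simp
  ring

theorem mdifferentiableAt_inner (hD : IsLeviCivita (fun x u v ↦ g.inner x u v) D) {x : M}
    {Y Z : ∀ x : M, TangentSpace 𝓘(ℝ, E) x}
    (hY : MDifferentiableAt 𝓘(ℝ, E) 𝓘(ℝ, E).tangent
      (fun z ↦ (⟨z, Y z⟩ : TangentBundle 𝓘(ℝ, E) M)) x)
    (hZ : MDifferentiableAt 𝓘(ℝ, E) 𝓘(ℝ, E).tangent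
      (fun z ↦ (⟨z, Z z⟩ : TangentBundle 𝓘(ℝ, E) M)) x) :
    MDifferentiableAt 𝓘(ℝ, E) 𝓘(ℝ, ℝ) (fun z ↦ g.inner z (Y z) (Z z)) x := by
  rw [mdifferentiableAt_section_iff] at hY hZ
  refine (mdifferentiableAt_iff_comp_symm (mem_chart_source _ x) _).2 ?_
  refine DifferentiableAt.congr_of_eventuallyEq
    (((((isChristoffelOn hD x).differentiableAt (mem_extChartAt_target x)).clm_apply
      hY).clm_apply hZ)) ?_
  filter_upwards [extChartAt_target_mem_nhds (I := 𝓘(ℝ, E)) x] with e he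
  rw [inner_eq_metricRep g (mem_chartAt_source_symm he), (extChartAt 𝓘(ℝ, E) x).right_inv he]
  rfl

theorem curvature_swap (hD : IsLeviCivita (fun x u v ↦ g.inner x u v) D) (x : M) (u v : E) :
    curvature D x u v = -curvature D x v u := by
  rw [curvature_apply hD, curvature_apply hD]
  abel

/-- With `w` the vector dual to `p`, the quantity is `g(R(u, v)w, w)`, so it vanishes by
`localCurvature_self`. -/
theorem coInner_pR_snd (hD : IsLeviCivita (fun x u v ↦ g.inner x u v) D) (ξ : CoBundle E M)
    (u v : TangentSpace 𝓘(ℝ, E) ξ.proj) : coInner g ξ.proj (pR D ξ u v) ξ.snd = 0 := by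
  have h1 (u v w : E) :
      metricRep g ξ.proj (extChartAt 𝓘(ℝ, E) ξ.proj ξ.proj) (curvature D ξ.proj u v w) w = 0 := by
    rw [curvature_apply hD]
    exact (isChristoffelOn hD ξ.proj).localCurvature_self (mem_extChartAt_target ξ.proj) u v w
  have h2 (v w : E) : metricRep g ξ.proj (extChartAt 𝓘(ℝ, E) ξ.proj ξ.proj) v w =
      g.inner ξ.proj v w := by
    refine (metricRep_apply g (mem_chart_source E ξ.proj) v w).trans ?_
    exact congrArg₂ (fun a b : TangentSpace 𝓘(ℝ, E) ξ.proj ↦ g.inner ξ.proj a b)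
      (tsy_self ξ.proj v) (tsy_self ξ.proj w)
  have h3 (r : TangentSpace 𝓘(ℝ, E) ξ.proj) :
      ξ.snd r = g.inner ξ.proj r (sharp g ξ.proj ξ.snd) := by
    rw [g.symm, inner_sharp]
  exact (h3 (curvature D ξ.proj u v (sharp g ξ.proj ξ.snd : E))).trans
    ((h2 _ _).symm.trans (h1 u v _))

theorem coInner_pR (hD : IsLeviCivita (fun x u v ↦ g.inner x u v) D) (ξ : CoBundle E M)
    (u v : TangentSpace 𝓘(ℝ, E) ξ.proj) (β : CoTan E ξ.proj) :
    coInner g ξ.proj (pR D ξ u v) β = -g.inner ξ.proj (pRsharp g D ξ u β) v := by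
  have h1 (w : E) (A B : E →L[ℝ] E) (p : E →L[ℝ] ℝ) (h : A = -B) : p (A w) = -p (B w) := by
    rw [h, _root_.neg_apply, map_neg]
  refine (h1 (sharp g ξ.proj β) _ _ ξ.snd (curvature_swap hD ξ.proj u v)).trans ?_
  have h2 : g.inner ξ.proj (pRsharp g D ξ u β) v =
      ξ.snd (curvature D ξ.proj v u (sharp g ξ.proj β : E)) := inner_sharp g ξ.proj _ v
  exact congrArg Neg.neg h2.symm

/-- The right-hand side collects the terms of the Koszul formula for `f g` in which the derivative
falls on `f`. -/
theorem inner_fA (x : M) (u v w : TangentSpace 𝓘(ℝ, E) x) (hf : 0 < f x) :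
    2 * (f x * g.inner x (fA g f x u v) w) =
      mvfderiv 𝓘(ℝ, E) f x u * g.inner x v w + mvfderiv 𝓘(ℝ, E) f x v * g.inner x u w -
        g.inner x u v * mvfderiv 𝓘(ℝ, E) f x w := by
  have h := inner_sharp g x (mvfderiv 𝓘(ℝ, E) f x) w
  rw [fA]
  simp only [map_smul, map_add, map_sub, _root_.add_apply, _root_.sub_apply, _root_.smul_apply,
    smul_eq_mul]
  rw [h]
  field_simp

theorem mvfderiv_mul_inner (hD : IsLeviCivita (fun x u v ↦ g.inner x u v) D) {x : M}
    (hf : MDifferentiableAt 𝓘(ℝ, E) 𝓘(ℝ, ℝ) f x)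
    {Y Z : ∀ x : M, TangentSpace 𝓘(ℝ, E) x}
    (hY : MDifferentiableAt 𝓘(ℝ, E) 𝓘(ℝ, E).tangent
      (fun z ↦ (⟨z, Y z⟩ : TangentBundle 𝓘(ℝ, E) M)) x)
    (hZ : MDifferentiableAt 𝓘(ℝ, E) 𝓘(ℝ, E).tangent
      (fun z ↦ (⟨z, Z z⟩ : TangentBundle 𝓘(ℝ, E) M)) x) (u : TangentSpace 𝓘(ℝ, E) x) :
    MDifferentiableAt 𝓘(ℝ, E) 𝓘(ℝ, ℝ) (fun z ↦ f z * g.inner z (Y z) (Z z)) x ∧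
    mvfderiv 𝓘(ℝ, E) (fun z ↦ f z * g.inner z (Y z) (Z z)) x u =
      f x * mvfderiv 𝓘(ℝ, E) (fun z ↦ g.inner z (Y z) (Z z)) x u +
        g.inner x (Y x) (Z x) * mvfderiv 𝓘(ℝ, E) f x u := by
  have h := mdifferentiableAt_inner hD hY hZ
  refine ⟨hf.mul h, ?_⟩
  rw [mvfderiv_fun_mul hf h]
  rfl

theorem mvfderiv_cgMetric_hliftField (hD : IsLeviCivita (fun x u v ↦ g.inner x u v) D)
    {ξ : CoBundle E M} (hf : MDifferentiableAt 𝓘(ℝ, E) 𝓘(ℝ, ℝ) f ξ.proj)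
    {Y Z : ∀ x : M, TangentSpace 𝓘(ℝ, E) x}
    (hY : MDifferentiableAt 𝓘(ℝ, E) 𝓘(ℝ, E).tangent
      (fun z ↦ (⟨z, Y z⟩ : TangentBundle 𝓘(ℝ, E) M)) ξ.proj)
    (hZ : MDifferentiableAt 𝓘(ℝ, E) 𝓘(ℝ, E).tangent
      (fun z ↦ (⟨z, Z z⟩ : TangentBundle 𝓘(ℝ, E) M)) ξ.proj) (ζ : CoTangent ξ) :
    mvfderiv (coModel E) (fun η ↦ cgMetric g f D η (hliftField D Y η) (hliftField D Z η)) ξ ζ =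
      f ξ.proj * mvfderiv 𝓘(ℝ, E) (fun z ↦ g.inner z (Y z) (Z z)) ξ.proj (hpart ξ ζ) +
        g.inner ξ.proj (Y ξ.proj) (Z ξ.proj) * mvfderiv 𝓘(ℝ, E) f ξ.proj (hpart ξ ζ) := by
  have h : (fun η : CoBundle E M ↦ cgMetric g f D η (hliftField D Y η) (hliftField D Z η)) =
      fun η ↦ (fun z ↦ f z * g.inner z (Y z) (Z z)) η.proj :=
    funext fun η ↦ cgMetric_hlift_hlift g f D η _ _
  have h1 := mvfderiv_mul_inner hD hf hY hZ (hpart ξ ζ)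
  rw [h, (mvfderiv_comp_proj h1.1).2, h1.2]

theorem mvfderiv_cgMetric_hliftField_vliftForm {ξ : CoBundle E M}
    (Y : ∀ x : M, TangentSpace 𝓘(ℝ, E) x) (θ : ∀ x : M, CoTan E x) (ζ : CoTangent ξ) :
    mvfderiv (coModel E) (fun η ↦ cgMetric g f D η (hliftField D Y η) (vliftForm θ η)) ξ ζ = 0 := by
  have h : (fun η : CoBundle E M ↦ cgMetric g f D η (hliftField D Y η) (vliftForm θ η)) =
      fun η ↦ 0 := funext fun η ↦ cgMetric_hlift_vlift g f D η _ _
  rw [h, mvfderiv_const]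
  rfl

theorem mvfderiv_cgMetric_vliftForm_hliftField {ξ : CoBundle E M}
    (Y : ∀ x : M, TangentSpace 𝓘(ℝ, E) x) (θ : ∀ x : M, CoTan E x) (ζ : CoTangent ξ) :
    mvfderiv (coModel E) (fun η ↦ cgMetric g f D η (vliftForm θ η) (hliftField D Y η)) ξ ζ = 0 := by
  have h : (fun η : CoBundle E M ↦ cgMetric g f D η (vliftForm θ η) (hliftField D Y η)) =
      fun η ↦ 0 := funext fun η ↦ cgMetric_vlift_hlift g f D η _ _
  rw [h, mvfderiv_const]
  rfl

-- The Koszul formula needs fields, while `eq_of_cgMetric` tests with single covectors; an extension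
-- differentiable at the one point is enough.
omit [FiniteDimensional ℝ E] in
theorem exists_form (x : M) (μ : CoTan E x) : ∃ θ : ∀ y : M, CoTan E y, θ x = μ ∧
    MDifferentiableAt 𝓘(ℝ, E) (coModel E) (fun z ↦ (⟨z, θ z⟩ : CoBundle E M)) x := by
  refine ⟨fun z ↦ cosy x z μ, ?_, mdifferentiableAt_cosy (mem_chart_source E x) μ⟩
  exact ContinuousLinearMap.ext fun v ↦ congrArg μ (tco_self (I := 𝓘(ℝ, E)) x v)

theorem exists_vectorField (x : M) (w : TangentSpace 𝓘(ℝ, E) x) :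
    ∃ Z : ∀ y : M, TangentSpace 𝓘(ℝ, E) y, Z x = w ∧
    MDifferentiableAt 𝓘(ℝ, E) 𝓘(ℝ, E).tangent
      (fun z ↦ (⟨z, Z z⟩ : TangentBundle 𝓘(ℝ, E) M)) x :=
  ⟨constField x w, constField_self x w, mdifferentiableAt_constField x w⟩

variable {ξ : CoBundle E M} {X Y : ∀ x : M, TangentSpace 𝓘(ℝ, E) x} {β θ : ∀ x : M, CoTan E x}

/-- Against horizontal lifts the Koszul formula reduces to that of `f g` on `M`. Against vertical
lifts only the vertical part of `[HX, HY]` survives: `f g(X, Y)` is constant on fibres, and the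
brackets `[HX, Vθ]` are vertical, hence orthogonal to horizontal lifts. -/
theorem leviCivita_hliftField_hliftField (hD : IsLeviCivita (fun x u v ↦ g.inner x u v) D)
    (hDt : IsLeviCivita (cgMetric g f D) Dt)
    (hf : MDifferentiableAt 𝓘(ℝ, E) 𝓘(ℝ, ℝ) f ξ.proj) (hpos : 0 < f ξ.proj)
    (hX : MDifferentiableAt 𝓘(ℝ, E) 𝓘(ℝ, E).tangent
      (fun z ↦ (⟨z, X z⟩ : TangentBundle 𝓘(ℝ, E) M)) ξ.proj)
    (hY : MDifferentiableAt 𝓘(ℝ, E) 𝓘(ℝ, E).tangent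
      (fun z ↦ (⟨z, Y z⟩ : TangentBundle 𝓘(ℝ, E) M)) ξ.proj) :
    Dt (hliftField D Y) ξ (hliftField D X ξ) =
      hlift D ξ (D Y ξ.proj (X ξ.proj) + fA g f ξ.proj (X ξ.proj) (Y ξ.proj)) +
        vlift ξ ((1 / 2 : ℝ) • pR D ξ (X ξ.proj) (Y ξ.proj)) := by
  have hX' := mdifferentiableAt_hliftField hD hX
  have hY' := mdifferentiableAt_hliftField hD hY
  refine eq_of_cgMetric g D hpos (fun w ↦ ?_) (fun μ ↦ ?_)
  · obtain ⟨Z, rfl, hZ⟩ := exists_vectorField ξ.proj w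
    have h := hDt.koszul (cgMetric_comm g f D) (cgMetric_sub_left g f D) hX' hY'
      (mdifferentiableAt_hliftField hD hZ)
    rw [mvfderiv_cgMetric_hliftField hD hf hY hZ, mvfderiv_cgMetric_hliftField hD hf hX hZ,
      mvfderiv_cgMetric_hliftField hD hf hX hY, mlieBracket_hliftField_hliftField hD ξ hX hY,
      mlieBracket_hliftField_hliftField hD ξ hX hZ,
      mlieBracket_hliftField_hliftField hD ξ hY hZ] at h
    simp only [hliftField, hpart_hlift] at h
    rw [cgMetric_hlift, cgMetric_hlift _ _ _ _ (_ + _), cgMetric_hlift _ _ _ _ (_ + _),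
      cgMetric_hlift _ _ _ _ (_ + _)] at h
    simp only [hpart_hlift_add_vlift] at h
    -- Multiplied by `f`, the Koszul formula on `M` accounts for all terms without derivatives of
    -- `f`; the remaining ones are `inner_fA`.
    have h1 := hD.koszul (fun y u v ↦ g.symm y u v)
      (fun y u v w ↦ by rw [map_sub, _root_.sub_apply]) hX hY hZ
    have h2 := inner_fA (g := g) ξ.proj (X ξ.proj) (Y ξ.proj) (Z ξ.proj) hpos
    rw [cgMetric_hlift, map_add, _root_.add_apply]
    simp only [hliftField]
    linear_combination (1 / 2) * h - (1 / 2) * f ξ.proj * h1 - (1 / 2) * h2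
  · obtain ⟨θ, rfl, hθ⟩ := exists_form ξ.proj μ
    have h := hDt.koszul (cgMetric_comm g f D) (cgMetric_sub_left g f D) hX' hY'
      (mdifferentiableAt_vliftForm hθ)
    rw [mvfderiv_cgMetric_hliftField_vliftForm, mvfderiv_cgMetric_hliftField_vliftForm,
      mvfderiv_cgMetric_hliftField hD hf hX hY, mlieBracket_hliftField_hliftField hD ξ hX hY,
      mlieBracket_hliftField_vliftForm hD ξ hX hθ,
      mlieBracket_hliftField_vliftForm hD ξ hY hθ] at h
    simp only [hliftField, vliftForm, hpart_vlift, map_zero, cgMetric_hlift_add_vlift,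
      cgMetric_vlift_hlift, mul_zero] at h
    rw [coInner_smul_left, coInner_smul_left, coInner_pR_snd hD]
    rw [cgMetric_vlift_vlift, coInner_pR_snd hD] at h
    simp only [hliftField]
    linear_combination (1 / 2) * h

/-- The horizontal part is dual to the previous formula: since `Vθ` and `HZ` are orthogonal, metric
compatibility moves the derivative from `Vθ` to `HZ`. The factor `1/α` comes from the vertical
product and `1/f` from the horizontal one. The vertical part uses that `α` and `p` are parallel in
horizontal directions, so that differentiation falls only on the forms. -/
theorem leviCivita_hliftField_vliftForm (hD : IsLeviCivita (fun x u v ↦ g.inner x u v) D)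
    (hDt : IsLeviCivita (cgMetric g f D) Dt)
    (hf : MDifferentiableAt 𝓘(ℝ, E) 𝓘(ℝ, ℝ) f ξ.proj) (hpos : 0 < f ξ.proj)
    (hX : MDifferentiableAt 𝓘(ℝ, E) 𝓘(ℝ, E).tangent
      (fun z ↦ (⟨z, X z⟩ : TangentBundle 𝓘(ℝ, E) M)) ξ.proj)
    (hθ : MDifferentiableAt 𝓘(ℝ, E) (coModel E) (fun z ↦ (⟨z, θ z⟩ : CoBundle E M)) ξ.proj) :
    Dt (vliftForm θ) ξ (hliftField D X ξ) =
      hlift D ξ ((1 / (2 * f ξ.proj * alpha g ξ)) • pRsharp g D ξ (X ξ.proj) (θ ξ.proj)) +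
        vlift ξ (covForm D θ ξ.proj (X ξ.proj)) := by
  have hX' := mdifferentiableAt_hliftField hD hX
  have hθ' := mdifferentiableAt_vliftForm hθ
  have hα := alpha_pos g ξ
  refine eq_of_cgMetric g D hpos (fun w ↦ ?_) (fun μ ↦ ?_)
  · obtain ⟨Z, rfl, hZ⟩ := exists_vectorField ξ.proj w
    have h := hDt.isMetric _ _ ξ hθ' (mdifferentiableAt_hliftField hD hZ) (hliftField D X ξ)
    rw [mvfderiv_cgMetric_vliftForm_hliftField] at h
    have h1 := leviCivita_hliftField_hliftField hD hDt hf hpos hX hZ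
    have h2 : cgMetric g f D ξ (vlift ξ (θ ξ.proj)) (Dt (hliftField D Z) ξ (hliftField D X ξ)) =
        (1 / alpha g ξ) * (1 / 2 *
          -g.inner ξ.proj (pRsharp g D ξ (X ξ.proj) (θ ξ.proj)) (Z ξ.proj)) := by
      rw [h1, cgMetric_comm, cgMetric_hlift_add_vlift, cgMetric_vlift_vlift,
        coInner_smul_left, coInner_smul_left, coInner_pR_snd hD, coInner_pR hD]
      ring
    have h4 : f ξ.proj * g.inner ξ.proj ((1 / (2 * f ξ.proj * alpha g ξ)) •
        pRsharp g D ξ (X ξ.proj) (θ ξ.proj)) (Z ξ.proj) = (1 / alpha g ξ) * ((1 / 2) *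
          g.inner ξ.proj (pRsharp g D ξ (X ξ.proj) (θ ξ.proj)) (Z ξ.proj)) := by
      rw [map_smul, _root_.smul_apply, smul_eq_mul]
      field_simp
    rw [h4]
    change 0 = cgMetric g f D ξ (Dt (vliftForm θ) ξ (hliftField D X ξ)) (hlift D ξ (Z ξ.proj)) +
      cgMetric g f D ξ (vlift ξ (θ ξ.proj)) (Dt (hliftField D Z) ξ (hliftField D X ξ)) at h
    linear_combination -h - h2
  · obtain ⟨μ, rfl, hμ⟩ := exists_form ξ.proj μ
    have h := hDt.koszul (cgMetric_comm g f D) (cgMetric_sub_left g f D) hX' hθ'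
      (mdifferentiableAt_vliftForm hμ)
    have h1 := mvfderiv_cgMetric_vliftForm hD f hθ hμ (hliftField D X ξ)
    rw [mvfderiv_cgMetric_hliftField_vliftForm, mvfderiv_cgMetric_hliftField_vliftForm,
      mlieBracket_hliftField_vliftForm hD ξ hX hθ,
      mlieBracket_hliftField_vliftForm hD ξ hX hμ,
      mlieBracket_vliftForm_vliftForm ξ hθ hμ] at h
    have h0 : cgMetric g f D ξ 0 (hliftField D X ξ) = 0 := by
      rw [← sub_self (hliftField D X ξ), cgMetric_sub_left, sub_self]
    rw [h0] at h
    generalize mvfderiv (coModel E)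
      (fun η ↦ cgMetric g f D η (vliftForm θ η) (vliftForm μ η)) ξ (hliftField D X ξ) = t at h h1
    simp only [vliftForm, cgMetric_vlift_vlift] at h h1
    simp only [hliftField, hpart_hlift, vpart_hlift, coInner_zero_left] at h h1
    simp only [hliftField]
    -- `h1` determines `α t`, whereas the Koszul identity `h` contains `t`; this relation converts
    -- one into the other.
    have ha : 1 / alpha g ξ * alpha g ξ = 1 := one_div_mul_cancel hα.ne'
    linear_combination (1 / 2) * h + (1 / alpha g ξ / 2) * h1 - t / 2 * ha

/-- Exchanging the two fields costs the bracket `[HX, Vθ]`, which is exactly the vertical part of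
the preceding formula. -/
theorem leviCivita_vliftForm_hliftField (hD : IsLeviCivita (fun x u v ↦ g.inner x u v) D)
    (hDt : IsLeviCivita (cgMetric g f D) Dt)
    (hf : MDifferentiableAt 𝓘(ℝ, E) 𝓘(ℝ, ℝ) f ξ.proj) (hpos : 0 < f ξ.proj)
    (hX : MDifferentiableAt 𝓘(ℝ, E) 𝓘(ℝ, E).tangent
      (fun z ↦ (⟨z, X z⟩ : TangentBundle 𝓘(ℝ, E) M)) ξ.proj)
    (hθ : MDifferentiableAt 𝓘(ℝ, E) (coModel E) (fun z ↦ (⟨z, θ z⟩ : CoBundle E M)) ξ.proj) :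
    Dt (hliftField D X) ξ (vliftForm θ ξ) =
      hlift D ξ ((1 / (2 * f ξ.proj * alpha g ξ)) • pRsharp g D ξ (X ξ.proj) (θ ξ.proj)) := by
  have h := hDt.sub_eq_mlieBracket (mdifferentiableAt_hliftField hD hX)
    (mdifferentiableAt_vliftForm hθ)
  rw [leviCivita_hliftField_vliftForm hD hDt hf hpos hX hθ,
    mlieBracket_hliftField_vliftForm hD ξ hX hθ, sub_eq_iff_eq_add, add_comm] at h
  exact (add_left_cancel h).symm

theorem covForm_zero (θ : ∀ x : M, CoTan E x) (x : M) : covForm D θ x 0 = 0 := by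
  have aux (A : E →L[ℝ] E →L[ℝ] ℝ) (p : E →L[ℝ] ℝ) (Γ : E →L[ℝ] E →L[ℝ] E) :
      A 0 - p.comp (Γ 0) = 0 := by simp
  exact aux _ (θ x) (christoffel D x)

/-- There is no horizontal part: by metric compatibility it is dual to the derivative of `HZ` along
`Vβ`, which is horizontal (the fibres are totally geodesic). For the vertical part all brackets
vanish and the forms are constant on fibres, so only the derivatives of `α` and of the pairings with
`p` contribute. -/
theorem leviCivita_vliftForm_vliftForm (hD : IsLeviCivita (fun x u v ↦ g.inner x u v) D)
    (hDt : IsLeviCivita (cgMetric g f D) Dt)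
    (hf : MDifferentiableAt 𝓘(ℝ, E) 𝓘(ℝ, ℝ) f ξ.proj) (hpos : 0 < f ξ.proj)
    (hβ : MDifferentiableAt 𝓘(ℝ, E) (coModel E) (fun z ↦ (⟨z, β z⟩ : CoBundle E M)) ξ.proj)
    (hθ : MDifferentiableAt 𝓘(ℝ, E) (coModel E) (fun z ↦ (⟨z, θ z⟩ : CoBundle E M)) ξ.proj) :
    Dt (vliftForm θ) ξ (vliftForm β ξ) = vlift ξ
      (-((1 / alpha g ξ) • (coInner g ξ.proj (β ξ.proj) ξ.snd • θ ξ.proj +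
        coInner g ξ.proj (θ ξ.proj) ξ.snd • β ξ.proj)) +
      (((alpha g ξ + 1) / alpha g ξ) * cgMetric g f D ξ (vliftForm β ξ) (vliftForm θ ξ)) • ξ.snd -
      ((1 / alpha g ξ) * (coInner g ξ.proj (β ξ.proj) ξ.snd *
        coInner g ξ.proj (θ ξ.proj) ξ.snd)) • ξ.snd) := by
  have hβ' := mdifferentiableAt_vliftForm hβ
  have hθ' := mdifferentiableAt_vliftForm hθ
  have hα := alpha_pos g ξ
  set W : CoTan E ξ.proj := -((1 / alpha g ξ) • (coInner g ξ.proj (β ξ.proj) ξ.snd • θ ξ.proj +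
        coInner g ξ.proj (θ ξ.proj) ξ.snd • β ξ.proj)) +
      (((alpha g ξ + 1) / alpha g ξ) * cgMetric g f D ξ (vliftForm β ξ) (vliftForm θ ξ)) • ξ.snd -
      ((1 / alpha g ξ) * (coInner g ξ.proj (β ξ.proj) ξ.snd *
        coInner g ξ.proj (θ ξ.proj) ξ.snd)) • ξ.snd with hW
  have hWi (μ : CoTan E ξ.proj) : coInner g ξ.proj W μ =
      -((1 / alpha g ξ) * (coInner g ξ.proj (β ξ.proj) ξ.snd * coInner g ξ.proj (θ ξ.proj) μ +
        coInner g ξ.proj (θ ξ.proj) ξ.snd * coInner g ξ.proj (β ξ.proj) μ)) +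
      (((alpha g ξ + 1) / alpha g ξ) * cgMetric g f D ξ (vliftForm β ξ) (vliftForm θ ξ)) *
        coInner g ξ.proj ξ.snd μ -
      ((1 / alpha g ξ) * (coInner g ξ.proj (β ξ.proj) ξ.snd *
        coInner g ξ.proj (θ ξ.proj) ξ.snd)) * coInner g ξ.proj ξ.snd μ := rfl
  have key : Dt (vliftForm θ) ξ (vliftForm β ξ) = hlift D ξ 0 + vlift ξ W := by
    refine eq_of_cgMetric g D hpos (fun w ↦ ?_) (fun μ ↦ ?_)
    · obtain ⟨Z, rfl, hZ⟩ := exists_vectorField ξ.proj w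
      have h := hDt.isMetric _ _ ξ hθ' (mdifferentiableAt_hliftField hD hZ) (vliftForm β ξ)
      rw [mvfderiv_cgMetric_vliftForm_hliftField,
        leviCivita_vliftForm_hliftField hD hDt hf hpos hZ hβ] at h
      simp only [vliftForm, hliftField, cgMetric_vlift_hlift, add_zero] at h
      simp only [vliftForm]
      rw [← h, map_zero, _root_.zero_apply, mul_zero]
    · obtain ⟨μ, rfl, hμ⟩ := exists_form ξ.proj μ
      have h := hDt.koszul (cgMetric_comm g f D) (cgMetric_sub_left g f D) hβ' hθ'
        (mdifferentiableAt_vliftForm hμ)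
      have h1 := mvfderiv_cgMetric_vliftForm hD f hθ hμ (vliftForm β ξ)
      have h2 := mvfderiv_cgMetric_vliftForm hD f hβ hμ (vliftForm θ ξ)
      have h3 := mvfderiv_cgMetric_vliftForm hD f hβ hθ (vliftForm μ ξ)
      have h0 (η : CoTangent ξ) : cgMetric g f D ξ 0 η = 0 := by
        rw [← sub_self η, cgMetric_sub_left, sub_self]
      rw [mlieBracket_vliftForm_vliftForm ξ hβ hθ, mlieBracket_vliftForm_vliftForm ξ hβ hμ,
        mlieBracket_vliftForm_vliftForm ξ hθ hμ, h0, h0, h0] at h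
      generalize mvfderiv (coModel E)
        (fun η ↦ cgMetric g f D η (vliftForm θ η) (vliftForm μ η)) ξ (vliftForm β ξ) = t1 at h h1
      generalize mvfderiv (coModel E)
        (fun η ↦ cgMetric g f D η (vliftForm β η) (vliftForm μ η)) ξ (vliftForm θ ξ) = t2 at h h2
      generalize mvfderiv (coModel E)
        (fun η ↦ cgMetric g f D η (vliftForm β η) (vliftForm θ η)) ξ (vliftForm μ ξ) = t3 at h h3
      rw [hWi, hWi]
      have hp : coInner g ξ.proj ξ.snd ξ.snd = alpha g ξ - 1 := by rw [alpha]; ring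
      simp only [vliftForm, cgMetric_vlift_vlift, hpart_vlift, vpart_vlift, covForm_zero,
        coInner_zero_left] at h h1 h2 h3 ⊢
      rw [coInner_comm g ξ.proj (μ ξ.proj) (β ξ.proj), coInner_comm g ξ.proj (μ ξ.proj) (θ ξ.proj)]
        at h3
      rw [coInner_comm g ξ.proj (θ ξ.proj) (β ξ.proj)] at h2
      rw [coInner_comm g ξ.proj ξ.snd (μ ξ.proj), hp]
      generalize coInner g ξ.proj (β ξ.proj) (θ ξ.proj) = bt at *
      generalize coInner g ξ.proj (β ξ.proj) (μ ξ.proj) = bm at *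
      generalize coInner g ξ.proj (θ ξ.proj) (μ ξ.proj) = tm at *
      generalize coInner g ξ.proj (β ξ.proj) ξ.snd = b at *
      generalize coInner g ξ.proj (θ ξ.proj) ξ.snd = c at *
      generalize coInner g ξ.proj (μ ξ.proj) ξ.snd = m at *
      generalize cgMetric g f D ξ _ (vlift ξ (μ ξ.proj)) = s at *
      generalize alpha g ξ = a at *
      have ha : 1 / a * a = 1 := one_div_mul_cancel hα.ne'
      -- Half of `h1 + h2 - h3` is the Koszul combination: the mixed terms `c * bm` and `b * tm`
      -- cancel, and the derivatives of `1 / α` in the three directions give the three products.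
      -- With `g⁻¹(p, p) = a - 1`, the comparison with `W` is an identity of rational functions.
      have hs : s = 1 / a * (bt * m - b * (1 / a * (tm + c * m)) - c * (1 / a * (bm + b * m)) +
          m * (1 / a * (bt + b * c))) := by
        linear_combination (1 / 2) * h + (1 / a / 2) * (h1 + h2 - h3) -
          (t1 + t2 - t3) / 2 * ha
      rw [hs]
      field_simp
      ring
  rw [key, show hlift D ξ 0 = 0 from map_zero (ContinuousLinearMap.prod
    (ContinuousLinearMap.id ℝ E) (christoffelForm D ξ)), zero_add]

end LeviCivita
-- The product conjugate connection
section Conjugate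

variable {E : Type*} [NormedAddCommGroup E] [NormedSpace ℝ E] [FiniteDimensional ℝ E]
  {M : Type*} [TopologicalSpace M] [ChartedSpace E M] [IsManifold 𝓘(ℝ, E) ∞ M]
  {g : Metric E M} {f : M → ℝ} {D : Conn E M} {Dt : CoConn E M}

theorem hpart_J (ξ : CoBundle E M) (ζ : CoTangent ξ) : hpart ξ (J D ξ ζ) = -hpart ξ ζ := rfl

theorem vpart_J (ξ : CoBundle E M) (ζ : CoTangent ξ) : vpart D ξ (J D ξ ζ) = vpart D ξ ζ := by
  have aux (u : E) (a : E →L[ℝ] ℝ) :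
      a - (2 : ℝ) • christoffelForm D ξ u - christoffelForm D ξ (-u) =
        a - christoffelForm D ξ u := by
    rw [map_neg]
    module
  exact aux (ζ : E × (E →L[ℝ] ℝ)).1 (ζ : E × (E →L[ℝ] ℝ)).2

theorem J_add (ξ : CoBundle E M) (ζ η : CoTangent ξ) :
    J D ξ (ζ + η) = J D ξ ζ + J D ξ η := (J D ξ).map_add ζ η

theorem J_smul (ξ : CoBundle E M) (c : ℝ) (ζ : CoTangent ξ) :
    J D ξ (c • ζ) = c • J D ξ ζ := (J D ξ).map_smul c ζ

theorem J_neg (ξ : CoBundle E M) (ζ : CoTangent ξ) : J D ξ (-ζ) = -J D ξ ζ := by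
  rw [← neg_one_smul ℝ ζ, J_smul, neg_one_smul]

theorem J_J (ξ : CoBundle E M) (ζ : CoTangent ξ) : J D ξ (J D ξ ζ) = ζ := by
  rw [← hlift_add_vlift D ξ ζ, J_add, J_hlift, J_vlift, J_add, J_neg, J_hlift, J_vlift,
    neg_neg]

theorem cgMetric_J (ξ : CoBundle E M) (ζ η : CoTangent ξ) :
    cgMetric g f D ξ (J D ξ ζ) (J D ξ η) = cgMetric g f D ξ ζ η := by
  rw [cgMetric, hpart_J, hpart_J, vpart_J, vpart_J, map_neg, map_neg, _root_.neg_apply, neg_neg]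
  rfl

/-- Since `J` is linear on fibres, additivity passes through it. In the Leibniz rule the term with
the derivative of the function carries `J (J Y) = Y`. -/
theorem isCovariantDerivativeOn_conjugate (hD : IsLeviCivita (fun x u v ↦ g.inner x u v) D)
    (Dt : CoConn E M) : IsCovariantDerivativeOn (E × (E →L[ℝ] ℝ)) (conjugate D Dt) where
  add {Y Z ξ} hY hZ _ := by
    have h : (fun η ↦ J D η ((Y + Z) η)) = (fun η ↦ J D η (Y η)) + fun η ↦ J D η (Z η) :=
      funext fun η ↦ J_add η (Y η) (Z η)
    have h1 := Dt.isCovariantDerivativeOnUniv.add (mdifferentiableAt_J hD hY)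
      (mdifferentiableAt_J hD hZ)
    refine ContinuousLinearMap.ext fun ζ ↦ ?_
    refine (congrArg (fun W ↦ J D ξ (Dt W ξ ζ)) h).trans ?_
    refine (congrArg (fun l : CoTangent ξ →L[ℝ] CoTangent ξ ↦ J D ξ (l ζ)) h1).trans ?_
    exact J_add ξ (Dt (fun η ↦ J D η (Y η)) ξ ζ) (Dt (fun η ↦ J D η (Z η)) ξ ζ)
  leibniz {Y h ξ} hY hh _ := by
    have h0 : (fun η ↦ J D η ((h • Y) η)) = h • fun η ↦ J D η (Y η) :=
      funext fun η ↦ J_smul η (h η) (Y η)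
    have h1 := Dt.isCovariantDerivativeOnUniv.leibniz (mdifferentiableAt_J hD hY) hh
    refine ContinuousLinearMap.ext fun ζ ↦ ?_
    refine (congrArg (fun W ↦ J D ξ (Dt W ξ ζ)) h0).trans ?_
    refine (congrArg (fun l : CoTangent ξ →L[ℝ] CoTangent ξ ↦ J D ξ (l ζ)) h1).trans ?_
    have h2 (c : ℝ) (a b : CoTangent ξ) (d : ℝ) :
        J D ξ (c • a + d • J D ξ b) = c • J D ξ a + d • b := by
      rw [J_add, J_smul, J_smul, J_J]
    exact h2 (h ξ) (Dt (fun η ↦ J D η (Y η)) ξ ζ) (Y ξ) (mvfderiv (coModel E) h ξ ζ)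

/-- Compatibility of `Dt` is applied to `J Y` and `J Z`, whose product is that of `Y` and `Z`. An
isometric involution is self-adjoint, which moves the outer `J` onto the derivative. -/
theorem isMetricFor_conjugate (hD : IsLeviCivita (fun x u v ↦ g.inner x u v) D)
    (hDt : IsLeviCivita (cgMetric g f D) Dt) :
    IsMetricFor (cgMetric g f D) (conjugate D Dt) := by
  intro Y Z ξ hY hZ ζ
  have h := hDt.isMetric _ _ ξ (mdifferentiableAt_J hD hY) (mdifferentiableAt_J hD hZ) ζ
  simp only [cgMetric_J] at h
  refine h.trans ?_
  have h1 (a b : CoTangent ξ) : cgMetric g f D ξ a (J D ξ b) = cgMetric g f D ξ (J D ξ a) b := by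
    rw [← cgMetric_J, J_J]
  have h2 (a b : CoTangent ξ) : cgMetric g f D ξ (J D ξ a) b = cgMetric g f D ξ a (J D ξ b) :=
    (h1 a b).symm
  exact congrArg₂ (fun s t : ℝ ↦ s + t) (h1 _ _) (h2 _ _)

variable {ξ : CoBundle E M}

theorem conjugate_vliftForm (θ : ∀ x : M, CoTan E x) (ζ : CoTangent ξ) :
    conjugate D Dt (vliftForm θ) ξ ζ = J D ξ (Dt (vliftForm θ) ξ ζ) := by
  have h : (fun η ↦ J D η (vliftForm θ η)) = vliftForm θ := funext fun η ↦ J_vlift D η _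
  exact congrArg (fun W ↦ J D ξ (Dt W ξ ζ)) h

theorem conjugate_hliftField (hD : IsLeviCivita (fun x u v ↦ g.inner x u v) D)
    {X : ∀ x : M, TangentSpace 𝓘(ℝ, E) x}
    (hX : MDifferentiableAt 𝓘(ℝ, E) 𝓘(ℝ, E).tangent
      (fun z ↦ (⟨z, X z⟩ : TangentBundle 𝓘(ℝ, E) M)) ξ.proj) (ζ : CoTangent ξ) :
    conjugate D Dt (hliftField D X) ξ ζ = -J D ξ (Dt (hliftField D X) ξ ζ) := by
  have h : (fun η ↦ J D η (hliftField D X η)) = (-1 : ℝ) • hliftField D X :=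
    funext fun η ↦ (J_hlift D η _).trans (neg_one_smul ℝ _).symm
  have h1 := Dt.isCovariantDerivativeOnUniv.smul_const (-1) (mdifferentiableAt_hliftField hD hX)
  refine (congrArg (fun W ↦ J D ξ (Dt W ξ ζ)) h).trans ?_
  refine (congrArg (fun l : CoTangent ξ →L[ℝ] CoTangent ξ ↦ J D ξ (l ζ)) h1).trans ?_
  exact (J_smul ξ (-1) (Dt (hliftField D X) ξ ζ)).trans (neg_one_smul ℝ _)

end Conjugate
end CheegerGromoll
end

theorem mainTheorem10 {E : Type*} [NormedAddCommGroup E] [NormedSpace ℝ E] [FiniteDimensional ℝ E]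
    {M : Type*} [TopologicalSpace M] [ChartedSpace E M] [IsManifold 𝓘(ℝ, E) ∞ M]
    (g : Metric E M) (f : M → ℝ) (hf : ContMDiff 𝓘(ℝ, E) 𝓘(ℝ, ℝ) ∞ f) (hpos : ∀ x, 0 < f x)
    (D : Conn E M) (hD : IsLeviCivita (fun x u v ↦ g.inner x u v) D)
    (Dt : CoConn E M) (hDt : IsLeviCivita (cgMetric g f D) Dt) :
    IsCovariantDerivativeOn (E × (E →L[ℝ] ℝ)) (conjugate D Dt) ∧
    IsMetricFor (cgMetric g f D) (conjugate D Dt) ∧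
    ∀ (X Y : ∀ x : M, TangentSpace 𝓘(ℝ, E) x) (β θ : ∀ x : M, CoTan E x),
      ContMDiff 𝓘(ℝ, E) (𝓘(ℝ, E).prod 𝓘(ℝ, E)) ∞
        (fun x ↦ (⟨x, X x⟩ : TangentBundle 𝓘(ℝ, E) M)) →
      ContMDiff 𝓘(ℝ, E) (𝓘(ℝ, E).prod 𝓘(ℝ, E)) ∞
        (fun x ↦ (⟨x, Y x⟩ : TangentBundle 𝓘(ℝ, E) M)) →
      ContMDiff 𝓘(ℝ, E) (coModel E) ∞ (fun x ↦ (⟨x, β x⟩ : CoBundle E M)) →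
      ContMDiff 𝓘(ℝ, E) (coModel E) ∞ (fun x ↦ (⟨x, θ x⟩ : CoBundle E M)) →
      ∀ ξ : CoBundle E M,
        conjugate D Dt (hliftField D Y) ξ (hliftField D X ξ) =
          hlift D ξ (D Y ξ.proj (X ξ.proj) + fA g f ξ.proj (X ξ.proj) (Y ξ.proj)) -
            (1 / 2 : ℝ) • vlift ξ (pR D ξ (X ξ.proj) (Y ξ.proj)) ∧
        conjugate D Dt (vliftForm θ) ξ (hliftField D X ξ) =
          -((1 / (2 * f ξ.proj * alpha g ξ)) •
              hlift D ξ (pRsharp g D ξ (X ξ.proj) (θ ξ.proj))) +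
            vlift ξ (covForm D θ ξ.proj (X ξ.proj)) ∧
        conjugate D Dt (hliftField D Y) ξ (vliftForm β ξ) =
          (1 / (2 * f ξ.proj * alpha g ξ)) • hlift D ξ (pRsharp g D ξ (Y ξ.proj) (β ξ.proj)) ∧
        conjugate D Dt (vliftForm θ) ξ (vliftForm β ξ) =
          -((1 / alpha g ξ) •
              (cgMetric g f D ξ (vliftForm β ξ) (liouville ξ) • vliftForm θ ξ +
                cgMetric g f D ξ (vliftForm θ ξ) (liouville ξ) • vliftForm β ξ)) +
            (((alpha g ξ + 1) / alpha g ξ) *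
              cgMetric g f D ξ (vliftForm β ξ) (vliftForm θ ξ)) • liouville ξ -
            ((1 / alpha g ξ) *
              (cgMetric g f D ξ (vliftForm β ξ) (liouville ξ) *
                cgMetric g f D ξ (vliftForm θ ξ) (liouville ξ))) • liouville ξ := by
  refine ⟨isCovariantDerivativeOn_conjugate hD Dt, isMetricFor_conjugate hD hDt, ?_⟩
  intro X Y β θ hX hY hβ hθ ξ
  have hf' : MDifferentiableAt 𝓘(ℝ, E) 𝓘(ℝ, ℝ) f ξ.proj := hf.mdifferentiableAt (by simp)
  have hX' := hX.mdifferentiableAt (x := ξ.proj) (by simp)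
  have hY' := hY.mdifferentiableAt (x := ξ.proj) (by simp)
  have hβ' := hβ.mdifferentiableAt (x := ξ.proj) (by simp)
  have hθ' := hθ.mdifferentiableAt (x := ξ.proj) (by simp)
  -- Each value is `J` of the Levi-Civita one, with an additional sign when the differentiated field
  -- is horizontal. Hence in i) and iii) the horizontal part is kept and the vertical one reversed,
  -- while in ii) and iv) it is the opposite.
  refine ⟨?_, ?_, ?_, ?_⟩
  · rw [conjugate_hliftField hD hY',
      leviCivita_hliftField_hliftField hD hDt hf' (hpos _) hX' hY', J_add, J_hlift, J_vlift,
      vlift_smul, neg_add, neg_neg, ← sub_eq_add_neg]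
  · rw [conjugate_vliftForm, leviCivita_hliftField_vliftForm hD hDt hf' (hpos _) hX' hθ', J_add,
      J_hlift, J_vlift, hlift_smul]
  · rw [conjugate_hliftField hD hY',
      leviCivita_vliftForm_hliftField hD hDt hf' (hpos _) hY' hβ', J_hlift, neg_neg, hlift_smul]
  · rw [conjugate_vliftForm, leviCivita_vliftForm_vliftForm hD hDt hf' (hpos _) hβ' hθ', J_vlift]
    have h1 : cgMetric g f D ξ (vliftForm β ξ) (liouville ξ) =
        coInner g ξ.proj (β ξ.proj) ξ.snd := cgMetric_vlift_liouville ξ _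
    have h2 : cgMetric g f D ξ (vliftForm θ ξ) (liouville ξ) =
        coInner g ξ.proj (θ ξ.proj) ξ.snd := cgMetric_vlift_liouville ξ _
    rw [h1, h2]
    simp only [sub_eq_add_neg, vlift_add, vlift_neg, vlift_smul]
    rfl
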